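/- Graphs are undirected, without loops or multiple edges, and have a non-empty vertex set. For a positive integer $k$, a graph $G$ has the $k$-extension property if for all non-negative integers $a,b$ with $a+b=k$ and all vertices $v_1,\dots,v_a,u_1,\dots,u_b$ of $G$ (repetitions allowed) with $v_i\neq u_j$ for all $i,j$, there is a vertex $z$ adjacent to every $v_i$ and, for every $j$, different from and not adjacent to $u_j$. Let $\mathcal{E}_1^2$ be the class of sentences $\exists X\,\phi(X)$, where $X$ is a single variable for a set of vertices and $\phi(X)$ is a first order sentence of quantifier depth at most $2$ over adjacency, equality and the unary predicate $X$. A sentence does not differ between $G$ and $H$ if it is true on both or false on both. For a set $X$ of vertices let $\mathrm{cl}(X)$ say that $X$ is a clique (any two distinct vertices of $X$ are adjacent), let $\max\mathrm{cl}(X)$ say that moreover no vertex outside $X$ is adjacent to all vertices of $X$, and let $\varphi_C(X)$ say that some vertex outside $X$ is adjacent to no vertex of $X$. Let $\mathrm{ind}(X)$ say that $X$ is an independent set (no two vertices of $X$ are adjacent), let $\max\mathrm{ind}(X)$ say that moreover every vertex outside $X$ is adjacent to some vertex of $X$, and let $\varphi_I(X)$ say that some vertex outside $X$ is adjacent to all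 vertices of $X$. Put $$\varphi^1_C=\forall X\,[\mathrm{cl}(X)\to\varphi_C(X)],\quad \varphi^2_C=\forall X\,[\max\mathrm{cl}(X)\to\neg\varphi_C(X)],\quad \varphi^3_C=\forall X\,[(\mathrm{cl}(X)\wedge\neg\varphi_C(X))\to\max\mathrm{cl}(X)],$$ $$\varphi^1_I=\forall X\,[\mathrm{ind}(X)\to\varphi_I(X)],\quad \varphi^2_I=\forall X\,[\max\mathrm{ind}(X)\to\neg\varphi_I(X)],\quad \varphi^3_I=\forall X\,[(\mathrm{ind}(X)\wedge\neg\varphi_I(X))\to\max\mathrm{ind}(X)].$$ Theorem. (1) There is a positive integer $s$ such that, if graphs $G$ and $H$ (finite or infinite) have the $s$-extension property and none of $\varphi^1_C,\varphi^2_C,\varphi^3_C,\varphi^1_I,\varphi^2_I,\varphi^3_I$ differs between $G$ and $H$, then no sentence of $\mathcal{E}_1^2$ differs between $G$ and $H$. (2) The set of these six sentences is minimal in the following sense. For every positive integer $s$, for $Q\in\{C,I\}$, and for every $$\varphi\in\{\varphi^1_Q,\ \neg\varphi^1_Q\wedge\neg\varphi^2_Q\wedge\varphi^3_Q,\ \neg\varphi^1_Q\wedge\neg\varphi^2_Q\wedge\neg\varphi^3_Q,\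 \varphi^2_Q\wedge\varphi^3_Q,\ \varphi^2_Q\wedge\neg\varphi^3_Q\},$$ there is a finite graph $G$ with the $s$-extension property such that $G\models\varphi$. -/

import Mathlib

namespace MonadicGraph

universe u

open FirstOrder

/-! ### The class of sentences `∃ X, φ(X)` with `φ` first order of quantifier depth at most two -/

/-- Relation symbols: adjacency (binary) and the monadic predicate `X` (unary). -/
inductive GraphSetRel : ℕ → Type
  | adj : GraphSetRel 2
  | mem : GraphSetRel 1

/-- The first order language of graphs with one additional unary predicate `X`. -/
def graphSetLanguage : Language := ⟨fun _ => Empty, GraphSetRel⟩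

/-- A graph `G` with a set `X` of vertices, as a first order structure. -/
@[reducible]
def graphSetStructure {V : Type u} (G : SimpleGraph V) (X : Set V) :
    graphSetLanguage.Structure V where
  funMap := fun f _ => Empty.elim f
  RelMap := fun r =>
    match r with
    | .adj => fun x => G.Adj (x 0) (x 1)
    | .mem => fun x => x 0 ∈ X

/-- Quantifier depth. In Mathlib's syntax `¬`, `∧`, `∨`, `↔` and `∃` are abbreviations built
from `⊥`, `→` and `∀`, with `∃ x, φ` standing for `¬ ∀ x, ¬ φ`, so that each `∃` counts once. -/
def quantifierDepth {L : Language} {α : Type} : {n : ℕ} → L.BoundedFormula α n → ℕ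
  | _, .falsum => 0
  | _, .equal _ _ => 0
  | _, .rel _ _ => 0
  | _, .imp φ ψ => max (quantifierDepth φ) (quantifierDepth ψ)
  | _, .all φ => quantifierDepth φ + 1

/-- An existential monadic second order sentence `∃ X, φ(X)` with a single monadic variable `X`,
where `φ` is a first order sentence of quantifier depth at most two. -/
structure E12Sentence where
  /-- The first order part `φ(X)`. -/
  firstOrderPart : graphSetLanguage.Sentence
  depth_le : quantifierDepth firstOrderPart ≤ 2

/-- `G ⊨ ∃ X, φ(X)`. -/
def E12Sentence.Holds {V : Type u} (Ψ : E12Sentence) (G : SimpleGraph V) : Prop :=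
  ∃ X : Set V, @Language.Sentence.Realize graphSetLanguage V (graphSetStructure G X)
    Ψ.firstOrderPart

/-! ### The extension property -/

/-- The `k`-extension property of `G`. The `v i` need not be distinct, nor need the `w j`. -/
def ExtensionProperty {V : Type u} (k : ℕ) (G : SimpleGraph V) : Prop :=
  ∀ a b : ℕ, a + b = k → ∀ (v : Fin a → V) (w : Fin b → V), (∀ i j, v i ≠ w j) →
    ∃ z : V, (∀ i, G.Adj z (v i)) ∧ ∀ j, ¬ G.Adj z (w j) ∧ z ≠ w j

/-! ### The six monadic sentences -/

section Sentences

variable {V : Type u} (G : SimpleGraph V)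

/-- `X` is a maximal clique: a clique without an external vertex adjacent to all of `X`. -/
def MaxClique (X : Set V) : Prop :=
  G.IsClique X ∧ ¬ ∃ x, x ∉ X ∧ ∀ y ∈ X, G.Adj x y

/-- Some external vertex is not adjacent to any vertex of `X`. -/
def ExtNonAdj (X : Set V) : Prop :=
  ∃ x, x ∉ X ∧ ∀ y ∈ X, ¬ G.Adj x y

/-- `X` is a maximal independent set: an independent set such that every external vertex is
adjacent to some vertex of `X`. -/
def MaxIndep (X : Set V) : Prop :=
  G.IsIndepSet X ∧ ¬ ∃ x, x ∉ X ∧ ∀ y ∈ X, ¬ G.Adj x y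

/-- Some external vertex is adjacent to all vertices of `X`. -/
def ExtAdj (X : Set V) : Prop :=
  ∃ x, x ∉ X ∧ ∀ y ∈ X, G.Adj x y

def PhiC1 : Prop := ∀ X : Set V, G.IsClique X → ExtNonAdj G X

def PhiC2 : Prop := ∀ X : Set V, MaxClique G X → ¬ ExtNonAdj G X

def PhiC3 : Prop := ∀ X : Set V, G.IsClique X ∧ ¬ ExtNonAdj G X → MaxClique G X

def PhiI1 : Prop := ∀ X : Set V, G.IsIndepSet X → ExtAdj G X

def PhiI2 : Prop := ∀ X : Set V, MaxIndep G X → ¬ ExtAdj G X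

def PhiI3 : Prop := ∀ X : Set V, G.IsIndepSet X ∧ ¬ ExtAdj G X → MaxIndep G X

/-- The five possible combinations of truth values of three sentences `p₁, p₂, p₃` such that
`p₁` implies `p₃` and `p₂` implies `¬ p₁`. -/
def FiveCases (p₁ p₂ p₃ : Prop) : Fin 5 → Prop :=
  ![p₁, ¬ p₁ ∧ ¬ p₂ ∧ p₃, ¬ p₁ ∧ ¬ p₂ ∧ ¬ p₃, p₂ ∧ p₃, p₂ ∧ ¬ p₃]

end Sentences

end MonadicGraph

/-!
(1) The truth of a sentence of quantifier depth two in `(G, X)` only depends on which profiles, that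
is, depth one types of vertices, occur. If some vertex fails to see some adjacency outside `X`, and
some vertex fails to see some adjacency inside `X`, then the extension property forces these to be
the same vertex `p`, and `X` is the set of neighbours or of non-neighbours of `p`, up to `p` itself.
Otherwise every vertex sees both adjacencies outside `X`, up to complementing `X`. Then a profile
only records the adjacencies to `X`. If some vertex of `X` sees both adjacencies inside `X`, then a
set defined by adjacencies to at most three vertices has the same profiles as `X`; such sets exist
in every graph with the extension property. If no vertex of `X` does so, then `X` is a clique or an
independent set, and the six sentences control which profiles occur outside `X`.

(2) The vertices are divided into classes, and the adjacencies between some of the classes are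
prescribed. The remaining ones are chosen at random, so that every pattern on few vertices is
realized in every class that does not contradict it. As classes are independent, a clique is such a
small set: an external vertex adjacent to all or to no vertices of a clique can only be missing
because of the prescribed adjacencies. Independent sets are reduced to cliques by complementation.
-/

namespace MonadicGraph

open FirstOrder

/-! ### The Ehrenfeucht–Fraïssé game -/

section EhrenfeuchtFraisse

variable {L : Language} {M N : Type*} [L.Structure M] [L.Structure N] {n : ℕ}

/-- The tuples `x` and `y` satisfy the same atomic formulas. -/
def SameAtoms (L : Language) [L.Structure M] [L.Structure N] (x : Fin n → M) (y : Fin n → N) :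
    Prop :=
  ∀ φ : L.BoundedFormula Empty n, φ.IsAtomic → (φ.Realize default x ↔ φ.Realize default y)

/-- Duplicator wins the Ehrenfeucht–Fraïssé game with `k` rounds from the position `(x, y)`. -/
def BackAndForth (L : Language) [L.Structure M] [L.Structure N] :
    ℕ → {n : ℕ} → (Fin n → M) → (Fin n → N) → Prop
  | 0, _, x, y => SameAtoms L x y
  | k + 1, n, x, y => SameAtoms L x y ∧
      (∀ p, ∃ q, BackAndForth L k (Fin.snoc x p : Fin (n + 1) → M) (Fin.snoc y q)) ∧
      ∀ q, ∃ p, BackAndForth L k (Fin.snoc x p : Fin (n + 1) → M) (Fin.snoc y q)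

theorem BackAndForth.sameAtoms {k : ℕ} {x : Fin n → M} {y : Fin n → N}
    (h : BackAndForth L k x y) : SameAtoms L x y := by
  cases k with
  | zero => exact h
  | succ k => exact h.1

theorem BackAndForth.realize_iff (φ : L.BoundedFormula Empty n) :
    ∀ {k : ℕ} {x : Fin n → M} {y : Fin n → N}, quantifierDepth φ ≤ k → BackAndForth L k x y →
      (φ.Realize default x ↔ φ.Realize default y) := by
  induction φ with
  | falsum => exact fun _ _ => Iff.rfl
  | equal t₁ t₂ => exact fun _ h => h.sameAtoms _ (.equal t₁ t₂)
  | rel R ts => exact fun _ h => h.sameAtoms _ (.rel R ts)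
  | imp φ ψ ihφ ihψ =>
    intro k x y hk h
    obtain ⟨hφ, hψ⟩ := max_le_iff.1 hk
    exact imp_congr (ihφ hφ h) (ihψ hψ h)
  | all φ ih =>
    intro k x y hk h
    obtain ⟨k, rfl⟩ := Nat.exists_eq_add_one_of_ne_zero (Nat.ne_zero_of_lt hk)
    have hφ : quantifierDepth φ ≤ k := Nat.le_of_succ_le_succ hk
    obtain ⟨-, forth, back⟩ := h
    constructor
    · intro hx q
      obtain ⟨p, hpq⟩ := back q
      exact (ih hφ hpq).1 (hx p)
    · intro hy p
      obtain ⟨q, hpq⟩ := forth p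
      exact (ih hφ hpq).2 (hy q)

end EhrenfeuchtFraisse

section Atoms

variable {V W : Type*} {n : ℕ}

theorem exists_eq_var (t : graphSetLanguage.Term (Empty ⊕ Fin n)) :
    ∃ i : Fin n, t = Language.Term.var (Sum.inr i) := by
  rcases t with (a | i) | ⟨f, _⟩
  · exact a.elim
  · exact ⟨i, rfl⟩
  · exact Empty.elim f

theorem sameAtoms_graphSetLanguage {G : SimpleGraph V} {X : Set V} {H : SimpleGraph W} {Y : Set W}
    {x : Fin n → V} {y : Fin n → W} (heq : ∀ i j, x i = x j ↔ y i = y j)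
    (hadj : ∀ i j, G.Adj (x i) (x j) ↔ H.Adj (y i) (y j)) (hmem : ∀ i, x i ∈ X ↔ y i ∈ Y) :
    letI := graphSetStructure G X
    letI := graphSetStructure H Y
    SameAtoms graphSetLanguage x y := by
  intro φ hφ
  rcases hφ with ⟨t₁, t₂⟩ | ⟨R, ts⟩
  · obtain ⟨i, rfl⟩ := exists_eq_var t₁
    obtain ⟨j, rfl⟩ := exists_eq_var t₂
    exact heq i j
  · choose f hf using fun j => exists_eq_var (ts j)
    obtain rfl : ts = fun j => Language.Term.var (Sum.inr (f j)) := funext hf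
    cases R with
    | adj => exact hadj (f 0) (f 1)
    | mem => exact hmem (f 0)

end Atoms

/-! ### Profiles of vertices -/

/-- The depth one type of a vertex `x` in a graph with a set `X` of vertices: whether `x ∈ X`, and
the set of pairs `(m, a)` such that `Sees G X x m a`. -/
abbrev Profile : Type := Bool × Set (Bool × Bool)

section Profiles

variable {V W : Type*} {G : SimpleGraph V} {X : Set V} {H : SimpleGraph W} {Y : Set W}

/-- Some vertex other than `x` has membership in `X` given by `m` and adjacency to `x` given by
`a`. -/
def Sees (G : SimpleGraph V) (X : Set V) (x : V) (m a : Bool) : Prop :=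
  ∃ z, z ≠ x ∧ (z ∈ X ↔ m) ∧ (G.Adj x z ↔ a)

open Classical in
/-- The profile of the vertex `x`. -/
noncomputable def profile (G : SimpleGraph V) (X : Set V) (x : V) : Profile :=
  (decide (x ∈ X), {t | Sees G X x t.1 t.2})

/-- The set of profiles of all vertices. -/
def profiles (G : SimpleGraph V) (X : Set V) : Set Profile := Set.range (profile G X)

theorem profile_eq_iff {x : V} {b : Bool} {T : Set (Bool × Bool)} :
    profile G X x = (b, T) ↔ (x ∈ X ↔ b) ∧ ∀ m a, Sees G X x m a ↔ (m, a) ∈ T := by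
  simp only [profile, Prod.mk.injEq, Set.ext_iff, Prod.forall, Set.mem_ofPred_eq]
  cases b <;> simp

theorem exists_iff_of_profile_eq {x : V} {y : W} (h : profile G X x = profile H Y y) (p : V) :
    ∃ q, (p = x ↔ q = y) ∧ (G.Adj x p ↔ H.Adj y q) ∧ (p ∈ X ↔ q ∈ Y) := by
  classical
  obtain ⟨hmem, hsees⟩ := profile_eq_iff.1 h
  rcases eq_or_ne p x with rfl | hp
  · exact ⟨y, by simp, by simp, by simpa using hmem⟩
  · obtain ⟨q, hq, hqY, hyq⟩ :=
      (hsees (decide (p ∈ X)) (decide (G.Adj x p))).1 ⟨p, hp, by simp, by simp⟩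
    exact ⟨q, by simp [hp, hq], by simpa using hyq.symm, by simpa using hqY.symm⟩

theorem backAndForth_one_of_profile_eq {x : V} {y : W} (h : profile G X x = profile H Y y) :
    letI := graphSetStructure G X
    letI := graphSetStructure H Y
    BackAndForth graphSetLanguage 1 ![x] ![y] := by
  have hxy : x ∈ X ↔ y ∈ Y := by simpa using (profile_eq_iff.1 h).1
  have extend {p : V} {q : W} (heq : p = x ↔ q = y) (hadj : G.Adj x p ↔ H.Adj y q)
      (hmem : p ∈ X ↔ q ∈ Y) :
      letI := graphSetStructure G X
      letI := graphSetStructure H Y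
      SameAtoms graphSetLanguage (Fin.snoc ![x] p : Fin 2 → V) (Fin.snoc ![y] q) := by
    refine sameAtoms_graphSetLanguage ?_ ?_ ?_ <;>
      simp [Fin.forall_fin_two, Fin.snoc, heq, hadj, hmem, hxy, eq_comm (a := x),
        eq_comm (a := y), G.adj_comm p, H.adj_comm q]
  refine ⟨sameAtoms_graphSetLanguage (by simp) (by simp) (by simp [hxy]), fun p => ?_, fun q => ?_⟩
  · obtain ⟨q, heq, hadj, hmem⟩ := exists_iff_of_profile_eq h p
    exact ⟨q, extend heq hadj hmem⟩
  · obtain ⟨p, heq, hadj, hmem⟩ := exists_iff_of_profile_eq h.symm q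
    exact ⟨p, extend heq.symm hadj.symm hmem.symm⟩

theorem realize_iff_of_profiles_eq (h : profiles G X = profiles H Y)
    (φ : graphSetLanguage.Sentence) (hφ : quantifierDepth φ ≤ 2) :
    @Language.Sentence.Realize graphSetLanguage V (graphSetStructure G X) φ ↔
      @Language.Sentence.Realize graphSetLanguage W (graphSetStructure H Y) φ := by
  let := graphSetStructure G X
  let := graphSetStructure H Y
  have start {p : V} {q : W} (hpq : profile G X p = profile H Y q) :
      BackAndForth graphSetLanguage 1 (Fin.snoc default p : Fin 1 → V)
        (Fin.snoc default q : Fin 1 → W) := by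
    convert backAndForth_one_of_profile_eq hpq using 1 <;> ext i <;> simp [Fin.snoc]
  refine BackAndForth.realize_iff φ hφ ⟨sameAtoms_graphSetLanguage (by simp) (by simp) (by simp),
    fun p => ?_, fun q => ?_⟩
  · obtain ⟨q, hq⟩ : profile G X p ∈ profiles H Y := h ▸ ⟨p, rfl⟩
    exact ⟨q, start hq.symm⟩
  · obtain ⟨p, hp⟩ : profile H Y q ∈ profiles G X := h ▸ ⟨q, rfl⟩
    exact ⟨p, start hp⟩

theorem E12Sentence.Holds.of_forall_exists_profiles_eq
    (h : ∀ X : Set V, ∃ Y : Set W, profiles G X = profiles H Y) {Ψ : E12Sentence}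
    (hΨ : Ψ.Holds G) : Ψ.Holds H := by
  obtain ⟨X, hX⟩ := hΨ
  obtain ⟨Y, hXY⟩ := h X
  exact ⟨Y, (realize_iff_of_profiles_eq hXY _ Ψ.depth_le).1 hX⟩

end Profiles

/-! ### The extension property -/

section Extension

variable {V : Type*} {G : SimpleGraph V} {s : ℕ}

theorem ExtensionProperty.exists_of_fintype (hG : ExtensionProperty s G) {ι κ : Type*} [Fintype ι]
    [Fintype κ] (hcard : Fintype.card ι + Fintype.card κ = s) (v : ι → V) (w : κ → V)
    (hvw : ∀ i j, v i ≠ w j) :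
    ∃ z, (∀ i, G.Adj z (v i)) ∧ ∀ j, ¬ G.Adj z (w j) ∧ z ≠ w j := by
  obtain ⟨z, hv, hw⟩ := hG _ _ hcard (v ∘ (Fintype.equivFin ι).symm)
    (w ∘ (Fintype.equivFin κ).symm) fun _ _ => hvw _ _
  exact ⟨z, fun i => by simpa using hv (Fintype.equivFin ι i),
    fun j => by simpa using hw (Fintype.equivFin κ j)⟩

theorem exists_subset_range_fin [Nonempty V] {t : ℕ} {S : Finset V} (hS : S.card ≤ t) :
    ∃ u : Fin t → V, (S : Set V) ⊆ Set.range u := by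
  obtain ⟨f⟩ : Nonempty (S ↪ Fin t) := Function.Embedding.nonempty_of_card_le (by simpa using hS)
  exact ⟨Function.extend f Subtype.val fun _ => Classical.arbitrary V,
    fun v hv => ⟨f ⟨v, hv⟩, f.injective.extend_apply ..⟩⟩

theorem ExtensionProperty.exists_pattern [Nonempty V] (hG : ExtensionProperty s G) (S : Finset V)
    (hS : S.card ≤ s) (p : V → Prop) : ∃ z, z ∉ S ∧ ∀ v ∈ S, (G.Adj v z ↔ p v) := by
  classical
  obtain ⟨u, hu⟩ := exists_subset_range_fin hS
  obtain ⟨z, hpos, hneg⟩ := hG.exists_of_fintype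
    (ι := {i // p (u i)}) (κ := {i // ¬ p (u i)})
    (by simpa using Fintype.card_congr (Equiv.sumCompl fun i => p (u i)))
    (fun i => u i) (fun j => u j) (fun i j h => j.2 (h ▸ i.2))
  have hadj : ∀ v ∈ S, (G.Adj v z ↔ p v) ∧ z ≠ v := by
    intro v hv
    obtain ⟨i, rfl⟩ := hu hv
    by_cases hp : p (u i)
    · exact ⟨iff_of_true (hpos ⟨i, hp⟩).symm hp, (hpos ⟨i, hp⟩).ne⟩
    · exact ⟨iff_of_false (fun h => (hneg ⟨i, hp⟩).1 h.symm) hp, (hneg ⟨i, hp⟩).2⟩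
  exact ⟨z, fun hz => (hadj z hz).2 rfl, fun v hv => (hadj v hv).1⟩

theorem extensionProperty_of_exists_pattern
    (h : ∀ S : Finset V, S.card ≤ s → ∀ p : V → Prop, ∃ z, z ∉ S ∧ ∀ v ∈ S, (G.Adj v z ↔ p v)) :
    ExtensionProperty s G := by
  classical
  intro a b hab v w hvw
  have hcard : (Finset.univ.image v ∪ Finset.univ.image w).card ≤ s := by
    calc (Finset.univ.image v ∪ Finset.univ.image w).card
        ≤ (Finset.univ.image v).card + (Finset.univ.image w).card := Finset.card_union_le _ _
      _ ≤ a + b := by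
          gcongr <;> exact Finset.card_image_le.trans_eq (Finset.card_fin _)
      _ = s := hab
  obtain ⟨z, hz, hadj⟩ := h _ hcard (· ∈ Set.range v)
  refine ⟨z, fun i => ((hadj (v i) (by simp)).2 ⟨i, rfl⟩).symm, fun j => ⟨fun hj => ?_, ?_⟩⟩
  · obtain ⟨i, hi⟩ := (hadj (w j) (by simp)).1 hj.symm
    exact hvw i j hi
  · rintro rfl
    exact hz (by simp)

theorem ExtensionProperty.compl [Nonempty V] (hG : ExtensionProperty s G) :
    ExtensionProperty s Gᶜ := by
  refine extensionProperty_of_exists_pattern fun S hS p => ?_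
  obtain ⟨z, hz, hadj⟩ := hG.exists_pattern S hS (¬ p ·)
  refine ⟨z, hz, fun v hv => ?_⟩
  have hvz : v ≠ z := fun h => hz (h ▸ hv)
  rw [SimpleGraph.compl_adj, hadj v hv, not_not]
  exact and_iff_right hvz

theorem ExtensionProperty.exists_adj_iff [Nonempty V] (hG : ExtensionProperty s G) {ι : Type*}
    [Fintype ι] (hι : Fintype.card ι ≤ s) {e : ι → V} (he : e.Injective) (p : ι → Prop) :
    ∃ z, (∀ i, z ≠ e i) ∧ ∀ i, (G.Adj (e i) z ↔ p i) := by
  classical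
  obtain ⟨z, hz, hadj⟩ := hG.exists_pattern (Finset.univ.image e)
    (Finset.card_image_le.trans hι) (fun v => ∃ i, e i = v ∧ p i)
  refine ⟨z, fun i hi => hz (by simp [hi]), fun i => ?_⟩
  rw [hadj _ (by simp)]
  simp [he.eq_iff]

theorem ExtensionProperty.exists_adj_iff_single [Nonempty V] (hG : ExtensionProperty s G)
    (hs : 1 ≤ s) (x : V) (p : Prop) : ∃ z, z ≠ x ∧ (G.Adj x z ↔ p) := by
  obtain ⟨z, hz, hadj⟩ := hG.exists_adj_iff (e := fun _ : Unit => x) (by simpa using hs)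
    (Function.injective_of_subsingleton _) (fun _ => p)
  exact ⟨z, hz (), hadj ()⟩

theorem ExtensionProperty.exists_adj_iff_insert [Nonempty V] (hG : ExtensionProperty s G)
    {ι : Type*} [Fintype ι] (hι : Fintype.card ι + 1 ≤ s) {e : ι → V} (he : e.Injective)
    (p : ι → Prop) {x : V} (hx : x ∉ Set.range e) (q : Prop) :
    ∃ z, (∀ i, z ≠ e i) ∧ z ≠ x ∧ (∀ i, (G.Adj (e i) z ↔ p i)) ∧ (G.Adj x z ↔ q) := by
  obtain ⟨z, hz, hadj⟩ := hG.exists_adj_iff (e := fun o : Option ι => o.elim x e) (by simpa)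
    (Option.injective_iff.2 ⟨he, hx⟩) (·.elim q p)
  exact ⟨z, fun i => hz (some i), hz none, fun i => hadj (some i), hadj none⟩

theorem ExtensionProperty.exists_adj_iff_pair [Nonempty V] (hG : ExtensionProperty s G)
    (hs : 2 ≤ s) {u v : V} (huv : u ≠ v) (p q : Prop) :
    ∃ z, z ≠ u ∧ z ≠ v ∧ (G.Adj u z ↔ p) ∧ (G.Adj v z ↔ q) := by
  obtain ⟨z, hz⟩ := hG.exists_adj_iff_insert (e := fun _ : Unit => v) (by simpa using hs)
    (Function.injective_of_subsingleton _) (fun _ => q) (x := u) (by simpa using huv) p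
  exact ⟨z, by simpa [and_comm, and_left_comm] using hz⟩

theorem ExtensionProperty.exists_adj_iff_triple [Nonempty V] (hG : ExtensionProperty s G)
    (hs : 3 ≤ s) {u v w : V} (huv : u ≠ v) (huw : u ≠ w) (hvw : v ≠ w) (p q r : Prop) :
    ∃ z, z ≠ u ∧ (G.Adj u z ↔ p) ∧ (G.Adj v z ↔ q) ∧ (G.Adj w z ↔ r) := by
  obtain ⟨z, -, hzu, hadj, hu⟩ := hG.exists_adj_iff_insert
    (e := fun b : Bool => bif b then v else w) (by simpa using hs)
    (Bool.injective_iff.2 hvw.symm) (fun b => bif b then q else r) (x := u)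
    (by simpa using ⟨huw, huv⟩) p
  exact ⟨z, hzu, hu, hadj true, hadj false⟩

theorem ExtensionProperty.nonempty_embedding [Nonempty V] (hG : ExtensionProperty s G) {n : ℕ}
    (hn : n ≤ s + 1) (A : SimpleGraph (Fin n)) : Nonempty (A ↪g G) := by
  induction n with
  | zero => exact ⟨⟨Function.Embedding.ofIsEmpty, fun {i} => i.elim0⟩⟩
  | succ n ih =>
    obtain ⟨e⟩ := ih (by lia) (A.comap Fin.succ)
    obtain ⟨z, hz, hadj⟩ := hG.exists_adj_iff (by simpa using hn) e.injective
      (fun i => A.Adj i.succ 0)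
    have he : ((Fin.cons z e : Fin (n + 1) → V)).Injective :=
      Fin.cons_injective_iff.2 ⟨fun ⟨i, hi⟩ => hz i hi.symm, e.injective⟩
    refine ⟨⟨⟨Fin.cons z e, he⟩, fun {i j} => ?_⟩⟩
    cases i using Fin.cases <;> cases j using Fin.cases <;>
      simp [hadj, G.adj_comm z, A.adj_comm 0]

end Extension

/-! ### Complements of sets and of graphs -/

section Duality

variable {V W : Type*} {G : SimpleGraph V} {H : SimpleGraph W} {X : Set V} {x : V} {m a : Bool}

/-- The effect on profiles of replacing the set by its complement. -/
def Profile.flipMem (t : Profile) : Profile := (!t.1, {u | (!u.1, u.2) ∈ t.2})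

/-- The effect on profiles of replacing the graph by its complement. -/
def Profile.flipAdj (t : Profile) : Profile := (t.1, {u | (u.1, !u.2) ∈ t.2})

theorem sees_compl_set : Sees G Xᶜ x m a ↔ Sees G X x (!m) a := by
  refine exists_congr fun z => ?_
  cases m <;> simp

theorem sees_compl_graph : Sees Gᶜ X x m a ↔ Sees G X x m (!a) := by
  refine exists_congr fun z => and_congr_right fun hz => ?_
  cases a <;> simp [SimpleGraph.compl_adj, hz.symm]

theorem profiles_compl_set (G : SimpleGraph V) (X : Set V) :
    profiles G Xᶜ = Profile.flipMem '' profiles G X := by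
  rw [profiles, profiles, ← Set.range_comp]
  congr 1
  ext1 x
  exact profile_eq_iff.2 ⟨by simp [profile], fun m a => sees_compl_set⟩

theorem profiles_compl_graph (G : SimpleGraph V) (X : Set V) :
    profiles Gᶜ X = Profile.flipAdj '' profiles G X := by
  rw [profiles, profiles, ← Set.range_comp]
  congr 1
  ext1 x
  exact profile_eq_iff.2 ⟨by simp [profile], fun m a => sees_compl_graph⟩

theorem exists_profiles_eq_of_compl_set (h : ∃ Y, profiles G Xᶜ = profiles H Y) :
    ∃ Y, profiles G X = profiles H Y := by
  obtain ⟨Y, hXY⟩ := h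
  refine ⟨Yᶜ, ?_⟩
  rw [profiles_compl_set, ← hXY, ← profiles_compl_set, compl_compl]

theorem exists_profiles_eq_of_compl_graph (h : ∃ Y, profiles Gᶜ X = profiles Hᶜ Y) :
    ∃ Y, profiles G X = profiles H Y := by
  obtain ⟨Y, hXY⟩ := h
  refine ⟨Y, ?_⟩
  rw [← compl_compl G, ← compl_compl H, profiles_compl_graph Gᶜ, hXY, ← profiles_compl_graph]

theorem extNonAdj_compl : ExtNonAdj Gᶜ X ↔ ExtAdj G X := by
  refine exists_congr fun x => and_congr_right fun hx => forall₂_congr fun y hy => ?_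
  have hxy : x ≠ y := fun h => hx (h ▸ hy)
  simp [SimpleGraph.compl_adj, hxy]

theorem extAdj_compl : ExtAdj Gᶜ X ↔ ExtNonAdj G X := by
  rw [← extNonAdj_compl, compl_compl]

theorem maxClique_compl : MaxClique Gᶜ X ↔ MaxIndep G X :=
  and_congr (SimpleGraph.isClique_compl ..) (not_congr extAdj_compl)

theorem phiC1_compl : PhiC1 Gᶜ ↔ PhiI1 G := by
  simp only [PhiI1, PhiC1, SimpleGraph.isClique_compl, extNonAdj_compl]

theorem phiC2_compl : PhiC2 Gᶜ ↔ PhiI2 G := by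
  simp only [PhiI2, PhiC2, maxClique_compl, extNonAdj_compl]

theorem phiC3_compl : PhiC3 Gᶜ ↔ PhiI3 G := by
  simp only [PhiI3, PhiC3, SimpleGraph.isClique_compl, maxClique_compl, extNonAdj_compl]

end Duality

/-! ### Sets outside of which everything is seen -/

/-- The set of pairs `(m, a)` realized around a vertex that sees everything outside `X` and whose
adjacency to all other vertices of `X` is given by `b`. -/
def uniform (b : Bool) : Set (Bool × Bool) := {t | t.1 = true → t.2 = b}

section SeesOutside

variable {V : Type*} {G : SimpleGraph V} {X : Set V} {x : V} {s : ℕ}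

/-- Every vertex has both another neighbour and another non-neighbour outside `X`. -/
def SeesOutside (G : SimpleGraph V) (X : Set V) : Prop := ∀ x a, Sees G X x false a

theorem sees_true_iff {a : Bool} : Sees G X x true a ↔ ∃ y ∈ X, y ≠ x ∧ (G.Adj x y ↔ a) := by
  simp only [Sees, iff_true, and_left_comm]

theorem SeesOutside.profile_eq_univ_iff (h : SeesOutside G X) {b : Bool} :
    profile G X x = (b, Set.univ) ↔ (x ∈ X ↔ b) ∧ ∀ a, Sees G X x true a := by
  simp [profile_eq_iff, h x]

theorem SeesOutside.profile_eq_uniform_iff (h : SeesOutside G X) (hX : X.Nontrivial) {a b : Bool} :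
    profile G X x = (b, uniform a) ↔ (x ∈ X ↔ b) ∧ ∀ y ∈ X, y ≠ x → (G.Adj x y ↔ a) := by
  classical
  have hfalse (c : Bool) : Sees G X x false c ↔ (false, c) ∈ uniform a := by simp [uniform, h x]
  rw [profile_eq_iff, Bool.forall_bool, and_iff_right hfalse]
  simp only [sees_true_iff, uniform, Set.mem_ofPred_eq, forall_const]
  refine and_congr_right fun _ => ⟨fun hsees y hy hyx => ?_, fun hadj c => ⟨?_, ?_⟩⟩
  · simp [← (hsees (decide (G.Adj x y))).1 ⟨y, hy, hyx, by simp⟩]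
  · rintro ⟨y, hy, hyx, hc⟩
    rw [hadj y hy hyx, ← Bool.eq_iff_iff] at hc
    exact hc.symm
  · rintro rfl
    obtain ⟨y, hy, hyx⟩ := hX.exists_ne x
    exact ⟨y, hy, hyx, hadj y hy hyx⟩

theorem SeesOutside.exists_profile_eq (h : SeesOutside G X) (hX : X.Nontrivial) (x : V) :
    ∃ b, profile G X x = (b, Set.univ) ∨ ∃ a, profile G X x = (b, uniform a) := by
  classical
  refine ⟨decide (x ∈ X), or_iff_not_imp_left.2 fun hfull => ?_⟩
  simp only [h.profile_eq_univ_iff, decide_eq_true_eq, true_and, not_forall] at hfull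
  obtain ⟨a, ha⟩ := hfull
  refine ⟨!a, (h.profile_eq_uniform_iff hX).2 ⟨by simp, fun y hy hyx => ?_⟩⟩
  have hxy : ¬ (G.Adj x y ↔ a) := fun hxy => ha (sees_true_iff.2 ⟨y, hy, hyx, hxy⟩)
  cases a <;> simpa using hxy

theorem SeesOutside.false_univ_mem_profiles [Nonempty V] (hG : ExtensionProperty s G) (hs : 3 ≤ s)
    (h : SeesOutside G X) (hX : X.Nontrivial) : (false, Set.univ) ∈ profiles G X := by
  obtain ⟨y, -, hy, -⟩ := h (Classical.arbitrary V) true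
  have hyX : y ∉ X := by simpa using hy
  by_cases hsees : ∀ a, Sees G X y true a
  · exact ⟨y, h.profile_eq_univ_iff.2 ⟨by simpa, hsees⟩⟩
  obtain ⟨a, ha⟩ := not_forall.1 hsees
  obtain ⟨u, hu, v, hv, huv⟩ := hX
  have hyu : y ≠ u := fun h => hyX (h ▸ hu)
  have hyv : y ≠ v := fun h => hyX (h ▸ hv)
  obtain ⟨z, hzy, hyz, huz, hvz⟩ := hG.exists_adj_iff_triple hs hyu hyv huv a True False
  have hzX : z ∉ X := fun hz => ha (sees_true_iff.2 ⟨z, hz, hzy, hyz⟩)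
  have hne : ∀ w ∈ X, w ≠ z := fun w hw h => hzX (h ▸ hw)
  refine ⟨z, h.profile_eq_univ_iff.2 ⟨by simpa, Bool.forall_bool.2 ⟨?_, ?_⟩⟩⟩
  · exact sees_true_iff.2 ⟨v, hv, hne v hv, by simpa [G.adj_comm z] using hvz⟩
  · exact sees_true_iff.2 ⟨u, hu, hne u hu, by simpa [G.adj_comm z] using huz⟩

theorem SeesOutside.mem_profiles_iff [Nonempty V] (hG : ExtensionProperty s G) (hs : 3 ≤ s)
    (h : SeesOutside G X) (hX : X.Nontrivial) (t : Profile) :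
    t ∈ profiles G X ↔ t = (false, Set.univ) ∨
      (t = (true, Set.univ) ∧ (true, Set.univ) ∈ profiles G X) ∨
      ∃ b a, t = (b, uniform a) ∧ (b, uniform a) ∈ profiles G X := by
  constructor
  · rintro ⟨x, rfl⟩
    obtain ⟨_ | _, hx | ⟨a, hx⟩⟩ := h.exists_profile_eq hX x
    · exact .inl hx
    · exact .inr (.inr ⟨_, a, hx, x, hx⟩)
    · exact .inr (.inl ⟨hx, x, hx⟩)
    · exact .inr (.inr ⟨_, a, hx, x, hx⟩)
  · rintro (rfl | ⟨rfl, ht⟩ | ⟨b, a, rfl, ht⟩)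
    exacts [h.false_univ_mem_profiles hG hs hX, ht, ht]

theorem SeesOutside.false_uniform_true_mem_profiles_iff (h : SeesOutside G X)
    (hX : X.Nontrivial) : (false, uniform true) ∈ profiles G X ↔ ExtAdj G X := by
  refine exists_congr fun x => (h.profile_eq_uniform_iff hX).trans ?_
  simp only [Bool.false_eq_true, iff_false, iff_true]
  exact and_congr_right fun hx => forall₂_congr fun y hy =>
    forall_prop_of_true (ne_of_mem_of_not_mem hy hx)

theorem SeesOutside.false_uniform_false_mem_profiles_iff (h : SeesOutside G X)
    (hX : X.Nontrivial) : (false, uniform false) ∈ profiles G X ↔ ExtNonAdj G X := by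
  refine exists_congr fun x => (h.profile_eq_uniform_iff hX).trans ?_
  simp only [Bool.false_eq_true, iff_false]
  exact and_congr_right fun hx => forall₂_congr fun y hy =>
    forall_prop_of_true (ne_of_mem_of_not_mem hy hx)

end SeesOutside

/-! ### Sets described by few parameters -/

section Realize

variable {V W : Type*} [Nonempty V] [Nonempty W] {G : SimpleGraph V} {H : SimpleGraph W}
  {X : Set V} {s : ℕ}

theorem profiles_eq_of_forall_mem_iff_adj (hG : ExtensionProperty s G) (hs : 2 ≤ s) {p : V}
    {b m : Bool} (hp : p ∈ X ↔ m) (hX : ∀ z, z ≠ p → (z ∈ X ↔ (G.Adj p z ↔ b))) :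
    profiles G X = {(m, {t | t.1 = (t.2 == b)}), (true, Set.univ), (false, Set.univ)} := by
  have hprofile : profile G X p = (m, {t | t.1 = (t.2 == b)}) := by
    refine profile_eq_iff.2 ⟨hp, fun c a => ⟨fun ⟨z, hz, hc, ha⟩ => ?_, fun hca => ?_⟩⟩
    · rw [hX z hz, ha] at hc
      cases a <;> cases b <;> cases c <;> simp_all
    · obtain ⟨z, hz, ha⟩ := hG.exists_adj_iff_single (by lia) p a
      refine ⟨z, hz, ?_, ha⟩
      rw [hX z hz, ha, show c = (a == b) from hca]
      cases a <;> cases b <;> simp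
  have hprofile_of_ne {x : V} (hx : x ≠ p) {c : Bool} (hc : x ∈ X ↔ c) :
      profile G X x = (c, Set.univ) := by
    refine profile_eq_iff.2 ⟨hc, fun d a => iff_of_true ?_ trivial⟩
    obtain ⟨z, hzx, hzp, ha, hd⟩ := hG.exists_adj_iff_pair hs hx a (d = b)
    refine ⟨z, hzx, ?_, ha⟩
    rw [hX z hzp, hd]
    cases b <;> cases d <;> simp
  ext t
  constructor
  · rintro ⟨x, rfl⟩
    rcases eq_or_ne x p with rfl | hx
    · exact .inl hprofile
    · by_cases hxX : x ∈ X
      · exact .inr (.inl (hprofile_of_ne hx (by simpa)))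
      · exact .inr (.inr (hprofile_of_ne hx (by simpa)))
  · have huniv (c : Bool) : (c, Set.univ) ∈ profiles G X := by
      obtain ⟨x, hx, hadj⟩ := hG.exists_adj_iff_single (by lia) p (c = b)
      refine ⟨x, hprofile_of_ne hx ?_⟩
      rw [hX x hx, hadj]
      cases b <;> cases c <;> simp
    rintro (rfl | rfl | rfl)
    exacts [⟨p, hprofile⟩, huniv true, huniv false]

theorem exists_profiles_eq_of_forall_mem_iff_adj (hG : ExtensionProperty s G)
    (hH : ExtensionProperty s H) (hs : 2 ≤ s) {p : V} {b : Bool}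
    (hX : ∀ z, z ≠ p → (z ∈ X ↔ (G.Adj p z ↔ b))) : ∃ Y, profiles G X = profiles H Y := by
  classical
  obtain ⟨q⟩ := ‹Nonempty W›
  let Y : Set W := {z | if z = q then p ∈ X else H.Adj q z ↔ b}
  have hp : p ∈ X ↔ decide (p ∈ X) := by simp
  have hq : q ∈ Y ↔ decide (p ∈ X) := by simp [Y]
  have hY (z : W) (hz : z ≠ q) : z ∈ Y ↔ (H.Adj q z ↔ b) := by simp [Y, hz]
  exact ⟨Y, (profiles_eq_of_forall_mem_iff_adj hG hs hp hX).trans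
    (profiles_eq_of_forall_mem_iff_adj hH hs hq hY).symm⟩

theorem seesOutside_of_isClique (hG : ExtensionProperty s G) (hs : 2 ≤ s)
    (hX : G.IsClique X) : SeesOutside G X := by
  intro x a
  obtain ⟨y, hyx, hy⟩ := hG.exists_adj_iff_single (by lia) x a
  by_cases hyX : y ∈ X
  · obtain ⟨z, hzx, hzy, hxz, hyz⟩ := hG.exists_adj_iff_pair hs hyx.symm a False
    have hzX : z ∉ X := fun hz => hyz.1 (hX hyX hz hzy.symm)
    exact ⟨z, hzx, by simpa, hxz⟩
  · exact ⟨y, hyx, by simpa, hy⟩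

theorem profiles_empty (hG : ExtensionProperty s G) (hs : 2 ≤ s) :
    profiles G ∅ = {(false, {t | t.1 = false})} := by
  have hsees := seesOutside_of_isClique hG hs (X := ∅) (by simp)
  have hprofile (x : V) : profile G ∅ x = (false, {t | t.1 = false}) := by
    refine profile_eq_iff.2 ⟨by simp, fun m a => ?_⟩
    cases m <;> simp [hsees x, sees_true_iff]
  simp [profiles, funext hprofile]

theorem profiles_singleton (hG : ExtensionProperty s G) (hs : 2 ≤ s) (p : V) :
    profiles G {p} =
      {(true, {t | t.1 = false}), (false, uniform true), (false, uniform false)} := by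
  have hsees := seesOutside_of_isClique hG hs (X := {p}) (by simp)
  have hprofile : profile G {p} p = (true, {t | t.1 = false}) := by
    refine profile_eq_iff.2 ⟨by simp, fun m a => ?_⟩
    cases m <;> simp [hsees p, sees_true_iff]
  have hprofile_of_ne {x : V} (hx : x ≠ p) {b : Bool} (hb : G.Adj p x ↔ b) :
      profile G {p} x = (false, uniform b) := by
    refine profile_eq_iff.2 ⟨by simpa using hx, fun m a => ?_⟩
    cases m
    · simp [hsees x, uniform]
    · cases a <;> cases b <;> simp_all [sees_true_iff, uniform, hx.symm, G.adj_comm x]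
  ext t
  constructor
  · rintro ⟨x, rfl⟩
    rcases eq_or_ne x p with rfl | hx
    · exact .inl hprofile
    · by_cases hadj : G.Adj p x
      · exact .inr (.inl (hprofile_of_ne hx (by simpa)))
      · exact .inr (.inr (hprofile_of_ne hx (by simpa)))
  · have huniform (b : Bool) : (false, uniform b) ∈ profiles G {p} := by
      obtain ⟨x, hx, hb⟩ := hG.exists_adj_iff_single (by lia) p b
      exact ⟨x, hprofile_of_ne hx hb⟩
    rintro (rfl | rfl | rfl)
    exacts [⟨p, hprofile⟩, huniform true, huniform false]

theorem exists_profiles_eq_of_subsingleton (hG : ExtensionProperty s G)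
    (hH : ExtensionProperty s H) (hs : 2 ≤ s) (hX : X.Subsingleton) :
    ∃ Y, profiles G X = profiles H Y := by
  rcases hX.eq_empty_or_singleton with rfl | ⟨p, rfl⟩
  · exact ⟨∅, by rw [profiles_empty hG hs, profiles_empty hH hs]⟩
  · obtain ⟨q⟩ := ‹Nonempty W›
    exact ⟨{q}, by rw [profiles_singleton hG hs, profiles_singleton hH hs]⟩

theorem profiles_symmDiff_neighborSet (hG : ExtensionProperty s G) (hs : 3 ≤ s) {u v : V}
    (huv : u ≠ v) :
    profiles G (symmDiff (G.neighborSet u) (G.neighborSet v)) =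
      {(true, Set.univ), (false, Set.univ)} := by
  set X := symmDiff (G.neighborSet u) (G.neighborSet v)
  have hmem {z : V} {m : Bool} {p : Prop} (hu : G.Adj u z ↔ p) (hv : G.Adj v z ↔ ¬ (p ↔ m)) :
      z ∈ X ↔ m := by
    simp only [X, Set.mem_symmDiff, SimpleGraph.mem_neighborSet, hu, hv]
    cases m <;> grind
  have hsees (x : V) (m a : Bool) : Sees G X x m a := by
    by_cases hxu : x = u
    · obtain ⟨z, hzx, -, hu, hv⟩ := hG.exists_adj_iff_pair (by lia) huv a (¬ (a ↔ m))
      exact ⟨z, hxu ▸ hzx, hmem hu hv, hxu ▸ hu⟩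
    by_cases hxv : x = v
    · obtain ⟨z, -, hzx, hu, hv⟩ := hG.exists_adj_iff_pair (by lia) huv (¬ (a ↔ m)) a
      exact ⟨z, hxv ▸ hzx, hmem hu (hv.trans (by grind)), hxv ▸ hv⟩
    · obtain ⟨z, hzx, hx, hu, hv⟩ := hG.exists_adj_iff_triple hs hxu hxv huv a True (¬ m)
      exact ⟨z, hzx, hmem hu (hv.trans (by grind)), hx⟩
  have hprofile {x : V} {m : Bool} (hm : x ∈ X ↔ m) : profile G X x = (m, Set.univ) :=
    profile_eq_iff.2 ⟨hm, fun _ _ => iff_of_true (hsees x _ _) trivial⟩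
  ext t
  constructor
  · rintro ⟨x, rfl⟩
    by_cases hx : x ∈ X
    · exact .inl (hprofile (by simpa))
    · exact .inr (hprofile (by simpa))
  · rintro (rfl | rfl)
    · obtain ⟨z, -, hz, -⟩ := hsees u true true
      exact ⟨z, hprofile hz⟩
    · obtain ⟨z, -, hz, -⟩ := hsees u false true
      exact ⟨z, hprofile hz⟩

section CommonNeighbors

variable {ι : Type*} [Fintype ι] [Nontrivial ι] {e : ι → V} {sgn mem : ι → Bool}

/-- Up to the vertices `e i`, of which it contains those with `mem i`, the set `X` consists of the
vertices whose adjacency to each `e i` is given by `sgn i`; this is also the adjacency of `e i` to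
the other `e j` in `X`. -/
structure IsCommonNeighborSet (G : SimpleGraph V) (X : Set V) (e : ι → V) (sgn mem : ι → Bool) :
    Prop where
  injective : e.Injective
  apply_mem_iff : ∀ i, e i ∈ X ↔ mem i
  adj_of_mem : ∀ z ∈ X, ∀ i, z ≠ e i → (G.Adj (e i) z ↔ sgn i)
  mem_of_adj : ∀ z ∉ Set.range e, (∀ i, G.Adj (e i) z ↔ sgn i) → z ∈ X

variable (hX : IsCommonNeighborSet G X e sgn mem) (hG : ExtensionProperty s G)
  (hs : Fintype.card ι + 1 ≤ s)

include hX hG hs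

theorem IsCommonNeighborSet.profile_apply (i : ι) :
    profile G X (e i) = (mem i, uniform (sgn i)) := by
  refine profile_eq_iff.2 ⟨hX.apply_mem_iff i, ?_⟩
  rintro (_ | _) a
  · refine iff_of_true ?_ (by simp [uniform])
    obtain ⟨j, hji⟩ := exists_ne i
    classical
    obtain ⟨z, hz, hadj⟩ := hG.exists_adj_iff (Nat.le_of_succ_le hs) hX.injective
      (fun k => if k = i then a = true else ¬ sgn k = true)
    have hzX : z ∉ X := fun hzX => by
      have := hX.adj_of_mem z hzX j (hz j)
      simp only [hadj j, hji, if_false] at this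
      exact not_iff_self this
    exact ⟨z, hz i, by simpa, by simpa using hadj i⟩
  · simp only [sees_true_iff, uniform, Set.mem_ofPred_eq, forall_const]
    constructor
    · rintro ⟨z, hzX, hz, ha⟩
      rw [hX.adj_of_mem z hzX i hz, ← Bool.eq_iff_iff] at ha
      exact ha.symm
    · rintro rfl
      obtain ⟨z, hz, hadj⟩ := hG.exists_adj_iff (Nat.le_of_succ_le hs) hX.injective (sgn ·)
      exact ⟨z, hX.mem_of_adj z (fun ⟨k, hk⟩ => hz k hk.symm) hadj, hz i, hadj i⟩

theorem IsCommonNeighborSet.profile_of_notMem_range {x : V} (hx : x ∉ Set.range e) {b : Bool}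
    (hb : x ∈ X ↔ b) : profile G X x = (b, Set.univ) := by
  refine profile_eq_iff.2 ⟨hb, ?_⟩
  rintro (_ | _) a <;> refine iff_of_true ?_ trivial
  · obtain ⟨z, hz, hzx, hadj, ha⟩ := hG.exists_adj_iff_insert hs hX.injective (¬ sgn ·) hx a
    obtain ⟨i⟩ : Nonempty ι := inferInstance
    have hzX : z ∉ X := fun hzX =>
      not_iff_self ((hadj i).symm.trans (hX.adj_of_mem z hzX i (hz i)))
    exact ⟨z, hzx, by simpa, ha⟩
  · obtain ⟨z, hz, hzx, hadj, ha⟩ := hG.exists_adj_iff_insert hs hX.injective (sgn ·) hx a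
    exact ⟨z, hzx, by simpa using hX.mem_of_adj z (fun ⟨i, hi⟩ => hz i hi.symm) hadj, ha⟩

theorem IsCommonNeighborSet.profiles_eq :
    profiles G X = {(true, Set.univ), (false, Set.univ)} ∪
      Set.range fun i => (mem i, uniform (sgn i)) := by
  ext t
  constructor
  · rintro ⟨x, rfl⟩
    by_cases hx : x ∈ Set.range e
    · obtain ⟨i, rfl⟩ := hx
      exact .inr ⟨i, (hX.profile_apply hG hs i).symm⟩
    · by_cases hxX : x ∈ X
      · exact .inl (.inl (hX.profile_of_notMem_range hG hs hx (by simpa)))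
      · exact .inl (.inr (hX.profile_of_notMem_range hG hs hx (by simpa)))
  · have hnotMem {z : V} (hz : ∀ i, z ≠ e i) : z ∉ Set.range e := fun ⟨i, hi⟩ => hz i hi.symm
    rintro ((rfl | rfl) | ⟨i, rfl⟩)
    · obtain ⟨z, hz, hadj⟩ := hG.exists_adj_iff (Nat.le_of_succ_le hs) hX.injective (sgn ·)
      have hzX := hX.mem_of_adj z (hnotMem hz) hadj
      exact ⟨z, hX.profile_of_notMem_range hG hs (hnotMem hz) (by simpa)⟩
    · obtain ⟨z, hz, hadj⟩ := hG.exists_adj_iff (Nat.le_of_succ_le hs) hX.injective (¬ sgn ·)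
      obtain ⟨i⟩ : Nonempty ι := inferInstance
      have hzX : z ∉ X := fun hzX =>
        not_iff_self ((hadj i).symm.trans (hX.adj_of_mem z hzX i (hz i)))
      exact ⟨z, hX.profile_of_notMem_range hG hs (hnotMem hz) (by simpa)⟩
    · exact ⟨e i, hX.profile_apply hG hs i⟩

end CommonNeighbors

theorem exists_isCommonNeighborSet (hG : ExtensionProperty s G) {n : ℕ} (hn : n ≤ s + 1)
    {sgn mem : Fin n → Bool} (hsgn : ∀ i j, mem i → mem j → sgn i = sgn j) :
    ∃ (X : Set V) (e : Fin n → V), IsCommonNeighborSet G X e sgn mem := by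
  obtain ⟨e⟩ := hG.nonempty_embedding hn (.fromRel fun i j => mem j ∧ sgn i)
  refine ⟨{z | (∃ i, e i = z ∧ mem i) ∨ (z ∉ Set.range e ∧ ∀ i, G.Adj (e i) z ↔ sgn i)}, e,
    e.injective, fun i => by simp, ?_, fun z hz hadj => .inr ⟨hz, hadj⟩⟩
  rintro z (⟨j, rfl, hj⟩ | ⟨-, hadj⟩) i hz
  · have hij : i ≠ j := fun h => hz (h ▸ rfl)
    have := hsgn i j
    rw [e.map_adj_iff, SimpleGraph.fromRel_adj]
    grind
  · exact hadj i

theorem exists_profiles_eq_union_image (hG : ExtensionProperty s G) (hs : 4 ≤ s)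
    {R : Set (Bool × Bool)} (hR : (true, true) ∈ R → (true, false) ∉ R) :
    ∃ X, profiles G X = {(true, Set.univ), (false, Set.univ)} ∪
      (fun t => (t.1, uniform t.2)) '' R := by
  classical
  rcases R.eq_empty_or_nonempty with rfl | hne
  · obtain ⟨u⟩ := ‹Nonempty V›
    obtain ⟨v, hvu, -⟩ := hG.exists_adj_iff_single (by lia) u True
    exact ⟨_, by rw [profiles_symmDiff_neighborSet hG (by lia) hvu, Set.image_empty,
      Set.union_empty]⟩
  have := hne.to_subtype
  have hcard : Fintype.card R < 4 := by
    by_cases h : (true, true) ∈ R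
    exacts [Fintype.card_subtype_lt (hR h), Fintype.card_subtype_lt h]
  obtain ⟨f⟩ : Nonempty (R ↪ Fin 3) :=
    Function.Embedding.nonempty_of_card_le (by simpa using Nat.lt_succ_iff.1 hcard)
  let r : Fin 3 → R := Function.invFun f
  have hr : r.Surjective := Function.invFun_surjective f.injective
  have hsgn (t u : Bool × Bool) (ht : t ∈ R) (hu : u ∈ R) (ht₁ : t.1) (hu₁ : u.1) :
      t.2 = u.2 := by
    obtain ⟨_, _ | _⟩ := t <;> obtain ⟨_, _ | _⟩ := u <;> simp_all
  obtain ⟨X, e, hX⟩ := exists_isCommonNeighborSet hG (n := 3) (by lia)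
    (sgn := fun i => (r i).1.2) (mem := fun i => (r i).1.1)
    fun i j => hsgn _ _ (r i).2 (r j).2
  refine ⟨X, (hX.profiles_eq hG (by simpa using hs)).trans ?_⟩
  rw [Set.image_eq_range, ← hr.range_comp]
  rfl

end Realize

/-! ### Cliques -/

section Cliques

variable {V W : Type*} {G : SimpleGraph V} {H : SimpleGraph W} {X Y : Set V} {s : ℕ}

/-- The three sentences about cliques do not differ between `G` and `H`. -/
structure CliqueEquivalent (G : SimpleGraph V) (H : SimpleGraph W) : Prop where
  phiC1 : PhiC1 G ↔ PhiC1 H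
  phiC2 : PhiC2 G ↔ PhiC2 H
  phiC3 : PhiC3 G ↔ PhiC3 H

theorem CliqueEquivalent.symm (h : CliqueEquivalent G H) : CliqueEquivalent H G :=
  ⟨h.phiC1.symm, h.phiC2.symm, h.phiC3.symm⟩

theorem cliqueEquivalent_compl (h₁ : PhiI1 G ↔ PhiI1 H) (h₂ : PhiI2 G ↔ PhiI2 H)
    (h₃ : PhiI3 G ↔ PhiI3 H) : CliqueEquivalent Gᶜ Hᶜ :=
  ⟨by rwa [phiC1_compl, phiC1_compl], by rwa [phiC2_compl, phiC2_compl],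
    by rwa [phiC3_compl, phiC3_compl]⟩

theorem ExtNonAdj.anti (h : ExtNonAdj G Y) (hXY : X ⊆ Y) : ExtNonAdj G X := by
  obtain ⟨x, hxY, hx⟩ := h
  exact ⟨x, fun hxX => hxY (hXY hxX), fun y hy => hx y (hXY hy)⟩

theorem nontrivial_of_not_extNonAdj [Nonempty V] (hG : ExtensionProperty s G) (hs : 1 ≤ s)
    (hX : ¬ ExtNonAdj G X) : X.Nontrivial := by
  by_contra hX'
  rcases (Set.not_nontrivial_iff.1 hX').eq_empty_or_singleton with rfl | ⟨x, rfl⟩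
  · exact hX ⟨Classical.arbitrary V, by simp⟩
  · obtain ⟨z, hzx, hxz⟩ := hG.exists_adj_iff_single hs x False
    exact hX ⟨z, by simpa, by simpa [G.adj_comm z] using hxz⟩

theorem nontrivial_of_not_extAdj [Nonempty V] (hG : ExtensionProperty s G) (hs : 1 ≤ s)
    (hX : ¬ ExtAdj G X) : X.Nontrivial :=
  nontrivial_of_not_extNonAdj hG.compl hs (extNonAdj_compl.not.2 hX)

theorem exists_maxClique_superset (hX : G.IsClique X) : ∃ Y, X ⊆ Y ∧ MaxClique G Y := by
  obtain ⟨Y, hXY, hY⟩ := zorn_subset_nonempty {Y | G.IsClique Y}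
    (fun c hc hchain _ => ⟨⋃₀ c, (SimpleGraph.isClique_sUnion hchain.directedOn).2 hc,
      fun A hA => Set.subset_sUnion_of_mem hA⟩) X hX
  refine ⟨Y, hXY, hY.prop, fun ⟨x, hxY, hadj⟩ => ?_⟩
  have hinsert : G.IsClique (insert x Y) :=
    SimpleGraph.isClique_insert.2 ⟨hY.prop, fun y hy _ => hadj y hy⟩
  exact hxY (hY.le_of_ge hinsert (Set.subset_insert x Y) (Set.mem_insert x Y))

theorem mem_profiles_iff_of_isClique [Nonempty V] (hG : ExtensionProperty s G) (hs : 3 ≤ s)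
    (hX : G.IsClique X) (hX' : X.Nontrivial) (t : Profile) :
    t ∈ profiles G X ↔ t = (false, Set.univ) ∨ t = (true, uniform true) ∨
      (t = (false, uniform true) ∧ ExtAdj G X) ∨ (t = (false, uniform false) ∧ ExtNonAdj G X) := by
  have hsees := seesOutside_of_isClique hG (by lia) hX
  have hunif : (true, uniform true) ∈ profiles G X := by
    obtain ⟨x, hx⟩ := hX'.nonempty
    exact ⟨x, (hsees.profile_eq_uniform_iff hX').2
      ⟨by simpa, fun y hy hyx => by simpa using hX hx hy hyx.symm⟩⟩
  have huniv : (true, Set.univ) ∉ profiles G X := by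
    rintro ⟨x, hx⟩
    obtain ⟨hxX, htrue⟩ := hsees.profile_eq_univ_iff.1 hx
    obtain ⟨y, hy, hyx, hxy⟩ := sees_true_iff.1 (htrue false)
    exact absurd (hxy.1 (hX (by simpa using hxX) hy hyx.symm)) (by simp)
  have hunif_false : (true, uniform false) ∉ profiles G X := by
    rintro ⟨x, hx⟩
    obtain ⟨hxX, hadj⟩ := (hsees.profile_eq_uniform_iff hX').1 hx
    obtain ⟨y, hy, hyx⟩ := hX'.exists_ne x
    exact absurd ((hadj y hy hyx).1 (hX (by simpa using hxX) hy hyx.symm)) (by simp)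
  rw [hsees.mem_profiles_iff hG hs hX', ← hsees.false_uniform_true_mem_profiles_iff hX',
    ← hsees.false_uniform_false_mem_profiles_iff hX']
  simp only [Bool.exists_bool, hunif, huniv, hunif_false]
  tauto

theorem exists_isClique_extNonAdj_extAdj [Nonempty V] (hG : ExtensionProperty s G) (hs : 2 ≤ s) :
    ∃ X, G.IsClique X ∧ X.Nontrivial ∧ ExtNonAdj G X ∧ ExtAdj G X := by
  obtain ⟨u⟩ := ‹Nonempty V›
  obtain ⟨v, hvu, huv⟩ := hG.exists_adj_iff_single (by lia) u True
  have hext (p : Prop) : ∃ z, z ∉ ({u, v} : Set V) ∧ ∀ y ∈ ({u, v} : Set V), G.Adj z y ↔ p := by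
    obtain ⟨z, hzu, hzv, hu, hv⟩ := hG.exists_adj_iff_pair hs hvu.symm p p
    exact ⟨z, by simp [hzu, hzv], by simp [G.adj_comm z, hu, hv]⟩
  refine ⟨{u, v}, SimpleGraph.isClique_pair.2 fun _ => huv.2 trivial,
    Set.nontrivial_pair hvu.symm, ?_, ?_⟩
  · simpa only [ExtNonAdj, iff_false] using hext False
  · simpa only [ExtAdj, iff_true] using hext True

theorem CliqueEquivalent.exists_isClique [Nonempty W] (h : CliqueEquivalent G H)
    (hH : ExtensionProperty s H) (hs : 2 ≤ s) (hX : G.IsClique X) :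
    ∃ Y, H.IsClique Y ∧ Y.Nontrivial ∧ (ExtNonAdj G X ↔ ExtNonAdj H Y) ∧
      (ExtAdj G X ↔ ExtAdj H Y) := by
  by_cases hN : ExtNonAdj G X <;> by_cases hA : ExtAdj G X
  · obtain ⟨Y, hY, hY', hYN, hYA⟩ := exists_isClique_extNonAdj_extAdj hH hs
    exact ⟨Y, hY, hY', iff_of_true hN hYN, iff_of_true hA hYA⟩
  · have hH₂ : ¬ PhiC2 H := fun hH₂ => h.phiC2.2 hH₂ X ⟨hX, hA⟩ hN
    simp only [PhiC2, not_forall, not_not] at hH₂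
    obtain ⟨Y, ⟨hY, hYA⟩, hYN⟩ := hH₂
    exact ⟨Y, hY, nontrivial_of_not_extAdj hH (by lia) hYA, iff_of_true hN hYN,
      iff_of_false hA hYA⟩
  · have hH₃ : ¬ PhiC3 H := fun hH₃ => (h.phiC3.2 hH₃ X ⟨hX, hN⟩).2 hA
    simp only [PhiC3, not_forall] at hH₃
    obtain ⟨Y, ⟨hY, hYN⟩, hmax⟩ := hH₃
    exact ⟨Y, hY, nontrivial_of_not_extNonAdj hH (by lia) hYN, iff_of_false hN hYN,
      iff_of_true hA (by_contra fun hYA => hmax ⟨hY, hYA⟩)⟩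
  · have hH₁ : ¬ PhiC1 H := fun hH₁ => hN (h.phiC1.2 hH₁ X hX)
    simp only [PhiC1, not_forall] at hH₁
    obtain ⟨Z, hZ, hZN⟩ := hH₁
    obtain ⟨Y, hZY, hY, hYA⟩ := exists_maxClique_superset hZ
    exact ⟨Y, hY, nontrivial_of_not_extAdj hH (by lia) hYA,
      iff_of_false hN fun hYN => hZN (hYN.anti hZY), iff_of_false hA hYA⟩

theorem CliqueEquivalent.exists_profiles_eq [Nonempty V] [Nonempty W] (h : CliqueEquivalent G H)
    (hG : ExtensionProperty s G) (hH : ExtensionProperty s H) (hs : 3 ≤ s) (hX : G.IsClique X)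
    (hX' : X.Nontrivial) : ∃ Y, profiles G X = profiles H Y := by
  obtain ⟨Y, hY, hY', hN, hA⟩ := h.exists_isClique hH (by lia) hX
  refine ⟨Y, Set.ext fun t => ?_⟩
  rw [mem_profiles_iff_of_isClique hG hs hX hX', mem_profiles_iff_of_isClique hH hs hY hY', hN, hA]

theorem isClique_or_isIndepSet_of_forall_exists
    (hX : ∀ x ∈ X, ∃ a : Prop, ∀ y ∈ X, y ≠ x → (G.Adj x y ↔ a)) :
    G.IsClique X ∨ G.IsIndepSet X := by
  refine or_iff_not_imp_left.2 fun hclique u hu v hv huv hadj => hclique ?_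
  have hall {x : V} (hx : x ∈ X) {y : V} (hy : y ∈ X) (hyx : y ≠ x) (hxy : G.Adj x y) :
      ∀ z ∈ X, z ≠ x → G.Adj x z := by
    obtain ⟨a, ha⟩ := hX x hx
    exact fun z hz hzx => (ha z hz hzx).2 ((ha y hy hyx).1 hxy)
  have hu_all := hall hu hv huv.symm hadj
  intro x hx y hy hxy
  rcases eq_or_ne x u with rfl | hxu
  · exact hu_all y hy hxy.symm
  · exact hall hx hu hxu.symm (hu_all x hx hxu).symm y hy hxy.symm

end Cliques

/-! ### Transfer of sets between graphs with the extension property -/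

section Transfer

variable {V W : Type*} {G : SimpleGraph V} {H : SimpleGraph W} {X : Set V} {s : ℕ}

theorem SeesOutside.isClique_or_isIndepSet (h : SeesOutside G X) (hX : X.Nontrivial)
    (huniv : (true, Set.univ) ∉ profiles G X) : G.IsClique X ∨ G.IsIndepSet X := by
  refine isClique_or_isIndepSet_of_forall_exists fun x hx => ?_
  obtain ⟨b, hb | ⟨a, ha⟩⟩ := h.exists_profile_eq hX x
  · obtain rfl : b = true := by simpa [hx] using (h.profile_eq_univ_iff.1 hb).1
    exact absurd ⟨x, hb⟩ huniv
  · exact ⟨a, ((h.profile_eq_uniform_iff hX).1 ha).2⟩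

variable [Nonempty V] [Nonempty W]

theorem SeesOutside.exists_profiles_eq_of_mem (h : SeesOutside G X)
    (hG : ExtensionProperty s G) (hH : ExtensionProperty s H) (hs : 4 ≤ s) (hX : X.Nontrivial)
    (huniv : (true, Set.univ) ∈ profiles G X) : ∃ Y, profiles G X = profiles H Y := by
  have hR : (true, uniform true) ∈ profiles G X → (true, uniform false) ∉ profiles G X := by
    rintro ⟨x, hx⟩ ⟨y, hy⟩
    obtain ⟨hxX, hx⟩ := (h.profile_eq_uniform_iff hX).1 hx
    obtain ⟨hyX, hy⟩ := (h.profile_eq_uniform_iff hX).1 hy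
    rcases eq_or_ne x y with rfl | hxy
    · obtain ⟨z, hz, hzx⟩ := hX.exists_ne x
      simp_all
    · have := hx y (by simpa using hyX) hxy.symm
      have := hy x (by simpa using hxX) hxy
      simp_all [G.adj_comm]
  obtain ⟨Y, hY⟩ := exists_profiles_eq_union_image hH hs
    (R := {t | (t.1, uniform t.2) ∈ profiles G X}) hR
  refine ⟨Y, Set.ext fun t => ?_⟩
  rw [h.mem_profiles_iff hG (by lia) hX, hY]
  simp only [huniv, Set.mem_union, Set.mem_insert_iff, Set.mem_singleton_iff, Set.mem_image,
    Set.mem_ofPred_eq, Prod.exists, and_true]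
  grind

theorem SeesOutside.exists_profiles_eq (h : SeesOutside G X) (hG : ExtensionProperty s G)
    (hH : ExtensionProperty s H) (hs : 4 ≤ s) (hC : CliqueEquivalent G H)
    (hI : CliqueEquivalent Gᶜ Hᶜ) : ∃ Y, profiles G X = profiles H Y := by
  rcases X.subsingleton_or_nontrivial with hX | hX
  · exact exists_profiles_eq_of_subsingleton hG hH (by lia) hX
  by_cases huniv : (true, Set.univ) ∈ profiles G X
  · exact h.exists_profiles_eq_of_mem hG hH hs hX huniv
  rcases h.isClique_or_isIndepSet hX huniv with hclique | hindep
  · exact hC.exists_profiles_eq hG hH (by lia) hclique hX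
  · have hclique : Gᶜ.IsClique X := (SimpleGraph.isClique_compl ..).2 hindep
    exact exists_profiles_eq_of_compl_graph
      (hI.exists_profiles_eq hG.compl hH.compl (by lia) hclique hX)

theorem ExtensionProperty.mem_iff_of_not_sees (hG : ExtensionProperty s G) (hs : 1 ≤ s) {p : V}
    {a b : Bool} (ha : ¬ Sees G X p true a) (hb : ¬ Sees G X p false b) {z : V} (hz : z ≠ p) :
    z ∈ X ↔ (G.Adj p z ↔ b) := by
  have hin (w : V) (hw : w ≠ p) (hadj : G.Adj p w ↔ a) : w ∉ X := fun hwX =>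
    ha ⟨w, hw, by simpa, hadj⟩
  have hout (w : V) (hw : w ≠ p) (hadj : G.Adj p w ↔ b) : w ∈ X := by_contra fun hwX =>
    hb ⟨w, hw, by simpa, hadj⟩
  have hab : a ≠ b := by
    rintro rfl
    obtain ⟨w, hw, hadj⟩ := hG.exists_adj_iff_single hs p a
    exact hin w hw hadj (hout w hw hadj)
  refine ⟨fun hzX => ?_, hout z hz⟩
  have := mt (hin z hz) (not_not.2 hzX)
  cases a <;> cases b <;> simp_all

theorem ExtensionProperty.exists_forall_mem_iff_adj (hG : ExtensionProperty s G) (hs : 2 ≤ s)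
    (hX : ¬ SeesOutside G X) (hXc : ¬ SeesOutside G Xᶜ) :
    ∃ (p : V) (b : Bool), ∀ z, z ≠ p → (z ∈ X ↔ (G.Adj p z ↔ b)) := by
  simp only [SeesOutside, not_forall, sees_compl_set, Bool.not_false] at hX hXc
  obtain ⟨p, b, hp⟩ := hX
  obtain ⟨q, a, hq⟩ := hXc
  obtain rfl : p = q := by
    by_contra hpq
    obtain ⟨z, hzp, hzq, hb, ha⟩ := hG.exists_adj_iff_pair hs hpq b a
    by_cases hz : z ∈ X
    exacts [hq ⟨z, hzq, by simpa, ha⟩, hp ⟨z, hzp, by simpa, hb⟩]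
  exact ⟨p, b, fun z hz => hG.mem_iff_of_not_sees (by lia) hq hp hz⟩

theorem exists_profiles_eq (hG : ExtensionProperty s G) (hH : ExtensionProperty s H) (hs : 4 ≤ s)
    (hC : CliqueEquivalent G H) (hI : CliqueEquivalent Gᶜ Hᶜ) (X : Set V) :
    ∃ Y, profiles G X = profiles H Y := by
  by_cases hX : SeesOutside G X
  · exact hX.exists_profiles_eq hG hH hs hC hI
  by_cases hXc : SeesOutside G Xᶜ
  · exact exists_profiles_eq_of_compl_set (hXc.exists_profiles_eq hG hH hs hC hI)
  obtain ⟨p, b, hpb⟩ := hG.exists_forall_mem_iff_adj (by lia) hX hXc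
  exact exists_profiles_eq_of_forall_mem_iff_adj hG hH (by lia) hpb

theorem E12Sentence.holds_iff (hG : ExtensionProperty s G) (hH : ExtensionProperty s H)
    (hs : 4 ≤ s) (hC : CliqueEquivalent G H) (hI : CliqueEquivalent Gᶜ Hᶜ) (Ψ : E12Sentence) :
    Ψ.Holds G ↔ Ψ.Holds H :=
  ⟨.of_forall_exists_profiles_eq (exists_profiles_eq hG hH hs hC hI),
    .of_forall_exists_profiles_eq (exists_profiles_eq hH hG hs hC.symm hI.symm)⟩

end Transfer

/-! ### Random colourings -/

section Counting

theorem card_avoiding_le {E Z S : Type*} [Fintype E] [Fintype Z] [Fintype S]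
    (e : Z × S ↪ E) (p : S → Bool) :
    (Nat.card {f : E → Bool // ∀ z, ∃ v, f (e (z, v)) ≠ p v} : ℝ) ≤
      (1 - (1 / 2) ^ Fintype.card S) ^ Fintype.card Z * 2 ^ Fintype.card E := by
  classical
  let restrict (f : {f : E → Bool // ∀ z, ∃ v, f (e (z, v)) ≠ p v}) :
      (Z → {h : S → Bool // h ≠ p}) × ({x // ¬ x ∈ Set.range e} → Bool) :=
    (fun z => ⟨fun v => f.1 (e (z, v)), Function.ne_iff.2 (f.2 z)⟩, fun x => f.1 x)
  have hinj : Function.Injective restrict := by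
    rintro f g hfg
    ext x
    by_cases hx : x ∈ Set.range e
    · obtain ⟨⟨z, v⟩, rfl⟩ := hx
      exact congrFun (congrArg Subtype.val (congrFun (congrArg Prod.fst hfg) z)) v
    · exact congrFun (congrArg Prod.snd hfg) ⟨x, hx⟩
  have hpos : (1 : ℕ) ≤ 2 ^ Fintype.card S := Nat.one_le_two_pow
  have hrange : Fintype.card {x // x ∈ Set.range e} = Fintype.card S * Fintype.card Z := by
    rw [Set.card_range_of_injective e.injective, Fintype.card_prod, mul_comm]
  have hle : Fintype.card S * Fintype.card Z ≤ Fintype.card E :=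
    hrange ▸ Fintype.card_subtype_le _
  have hcompl : Fintype.card {x // ¬ x ∈ Set.range e} =
      Fintype.card E - Fintype.card S * Fintype.card Z := by
    rw [Fintype.card_subtype_compl, hrange]
  calc (Nat.card {f : E → Bool // ∀ z, ∃ v, f (e (z, v)) ≠ p v} : ℝ)
      ≤ Nat.card ((Z → {h : S → Bool // h ≠ p}) × ({x // ¬ x ∈ Set.range e} → Bool)) := by
        exact_mod_cast Nat.card_le_card_of_injective restrict hinj
    _ = (2 ^ Fintype.card S - 1) ^ Fintype.card Z *
          2 ^ (Fintype.card E - Fintype.card S * Fintype.card Z) := by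
        rw [Nat.card_eq_fintype_card, Fintype.card_prod, Fintype.card_fun, Fintype.card_fun, hcompl]
        simp [Nat.cast_sub hpos]
    _ = (1 - (1 / 2) ^ Fintype.card S) ^ Fintype.card Z *
          (2 ^ (Fintype.card S * Fintype.card Z) *
            2 ^ (Fintype.card E - Fintype.card S * Fintype.card Z)) := by
        rw [pow_mul, ← mul_assoc, ← mul_pow, sub_mul, ← mul_pow]
        norm_num
    _ = _ := by rw [← pow_add, Nat.add_sub_cancel' hle]

theorem exists_forall_exists_forall_eq {E I : Type*} [Finite E] [Fintype I] {t M : ℕ}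
    {Z S : I → Type*} [∀ i, Fintype (Z i)] [∀ i, Fintype (S i)]
    (e : ∀ i, Z i × S i ↪ E) (p : ∀ i, S i → Bool)
    (hS : ∀ i, Fintype.card (S i) ≤ t) (hZ : ∀ i, M ≤ Fintype.card (Z i))
    (hlt : (Fintype.card I : ℝ) * (1 - (1 / 2) ^ t) ^ M < 1) :
    ∃ f : E → Bool, ∀ i, ∃ z, ∀ v, f (e i (z, v)) = p i v := by
  classical
  have := Fintype.ofFinite E
  by_contra! hbad
  have hbound (i : I) : (Nat.card {f : E → Bool // ∀ z, ∃ v, f (e i (z, v)) ≠ p i v} : ℝ) ≤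
      (1 - (1 / 2) ^ t) ^ M * 2 ^ Fintype.card E := by
    have hpow : (1 / 2 : ℝ) ^ t ≤ (1 / 2) ^ Fintype.card (S i) :=
      pow_le_pow_of_le_one (by norm_num) (by norm_num) (hS i)
    have hpow' : (1 / 2 : ℝ) ^ Fintype.card (S i) ≤ 1 := pow_le_one₀ (by norm_num) (by norm_num)
    refine (card_avoiding_le (e i) (p i)).trans ?_
    gcongr ?_ * _
    calc (1 - (1 / 2 : ℝ) ^ Fintype.card (S i)) ^ Fintype.card (Z i)
        ≤ (1 - (1 / 2) ^ Fintype.card (S i)) ^ M :=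
          pow_le_pow_of_le_one (by linarith) (sub_le_self _ (by positivity)) (hZ i)
      _ ≤ (1 - (1 / 2) ^ t) ^ M := pow_le_pow_left₀ (by linarith) (by linarith) M
  choose i hi using hbad
  let toBad (f : E → Bool) : Σ i, {f : E → Bool // ∀ z, ∃ v, f (e i (z, v)) ≠ p i v} :=
    ⟨i f, f, hi f⟩
  have hinj : Function.Injective toBad := Function.LeftInverse.injective (g := fun x => x.2.1)
    fun _ => rfl
  have hle : (2 : ℝ) ^ Fintype.card E ≤
      ∑ i, (Nat.card {f : E → Bool // ∀ z, ∃ v, f (e i (z, v)) ≠ p i v} : ℝ) := by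
    have := Nat.card_le_card_of_injective toBad hinj
    rw [Nat.card_sigma] at this
    simpa using (Nat.cast_le (α := ℝ)).2 this
  have : (2 : ℝ) ^ Fintype.card E < 2 ^ Fintype.card E := by
    calc (2 : ℝ) ^ Fintype.card E ≤ _ := hle
      _ ≤ ∑ _i : I, (1 - (1 / 2 : ℝ) ^ t) ^ M * 2 ^ Fintype.card E :=
          Finset.sum_le_sum fun i _ => hbound i
      _ = (Fintype.card I * (1 - (1 / 2) ^ t) ^ M) * 2 ^ Fintype.card E := by
          rw [Finset.sum_const, Finset.card_univ, nsmul_eq_mul, mul_assoc]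
      _ < 1 * 2 ^ Fintype.card E := by gcongr
      _ = _ := one_mul _
  exact this.false

theorem exists_le_pow_mul_pow_lt_one (a : ℝ) (k : ℕ) {q : ℝ} (hq₀ : 0 ≤ q) (hq₁ : q < 1) :
    ∃ M, k ≤ M ∧ 0 < M ∧ a * (M ^ k * q ^ M) < 1 := by
  have hlim := (tendsto_pow_const_mul_const_pow_of_abs_lt_one k
    (by rwa [abs_of_nonneg hq₀])).const_mul a
  rw [mul_zero] at hlim
  exact (((Filter.eventually_ge_atTop k).and (Filter.eventually_gt_atTop 0)).and
    (hlim.eventually_lt_const one_pos)).exists.imp fun _ h => ⟨h.1.1, h.1.2, h.2⟩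

end Counting

/-! ### Generic graphs -/

/-- A set `C` of classes of vertices, with a prescribed adjacency (`some b`) or none between the
vertices of any two classes. The classes themselves are independent. -/
structure Template (C : Type*) where
  status : C → C → Option Bool
  symm (c d : C) : status c d = status d c
  self (c : C) : status c c = some false

section Generic

variable {C V : Type*}

/-- The graph on `V` respecting the template `T`, with the remaining adjacencies chosen by `f`;
the vertex `x` belongs to the class `cls x`. -/
def Template.blowup (T : Template C) (cls : V → C) (f : Sym2 V → Bool) : SimpleGraph V where
  Adj x y := x ≠ y ∧ (T.status (cls x) (cls y)).getD (f s(x, y)) = true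
  symm := ⟨fun x y h => ⟨h.1.symm, by rw [T.symm, Sym2.eq_swap]; exact h.2⟩⟩
  loopless := ⟨fun _ h => h.1 rfl⟩

/-- `G` respects the template `T`, and is generic otherwise: every assignment of adjacencies to at
most `t` vertices is realized in every class, as far as `T` leaves these adjacencies open. -/
structure IsGeneric (T : Template C) (t : ℕ) (cls : V → C) (G : SimpleGraph V) : Prop where
  adj_iff {x y : V} {b : Bool} (hxy : x ≠ y) (h : T.status (cls x) (cls y) = some b) :
    G.Adj x y ↔ b = true
  exists_pattern (c : C) {F : Finset V} (hF : F.card ≤ t) (p : V → Prop) :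
    ∃ z, cls z = c ∧ z ∉ F ∧ ∀ v ∈ F, T.status c (cls v) = none → (G.Adj v z ↔ p v)

theorem le_card_and_notMem_of_add_le [Finite V] {P : V → Prop} {U : Finset V} {M t : ℕ}
    (hP : M + t ≤ Nat.card {x // P x}) (hU : U.card ≤ t) :
    M ≤ Nat.card {x // P x ∧ x ∉ U} := by
  classical
  have := Fintype.ofFinite V
  have hsdiff := Finset.le_card_sdiff U (Finset.univ.filter P)
  rw [Nat.card_eq_fintype_card, Fintype.card_subtype] at hP ⊢
  rw [Finset.filter_and_not, Finset.filter_mem_eq_inter, Finset.univ_inter]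
  lia

theorem Template.exists_isGeneric_blowup [Fintype C] [Fintype V] [Nonempty V] (T : Template C)
    (cls : V → C) {t M : ℕ} (hcls : ∀ c, M + t ≤ Nat.card {x // cls x = c})
    (hlt : (Fintype.card (C × (Fin t → V × Bool)) : ℝ) * (1 - (1 / 2) ^ t) ^ M < 1) :
    ∃ f, IsGeneric T t cls (T.blowup cls f) := by
  classical
  let U (i : C × (Fin t → V × Bool)) : Finset V := Finset.univ.image fun j => (i.2 j).1
  let Z (i) := {z // cls z = i.1 ∧ z ∉ U i}
  let S (i) := {v // v ∈ U i ∧ T.status i.1 (cls v) = none}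
  let e (i) : Z i × S i ↪ Sym2 V := ⟨fun x => s(x.1.1, x.2.1), by
    rintro ⟨⟨z, hz⟩, ⟨v, hv⟩⟩ ⟨⟨z', hz'⟩, ⟨v', hv'⟩⟩ h
    rcases Sym2.eq_iff.1 h with ⟨rfl, rfl⟩ | ⟨rfl, rfl⟩
    · rfl
    · exact absurd hv'.1 hz.2⟩
  have hU (i) : (U i).card ≤ t := Finset.card_image_le.trans_eq (Finset.card_fin t)
  have hS (i) : Fintype.card (S i) ≤ t :=
    (Fintype.card_subtype_mono _ (· ∈ U i) fun v hv => hv.1).trans (by simpa using hU i)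
  have hZ (i) : M ≤ Fintype.card (Z i) := by
    simpa [Z] using le_card_and_notMem_of_add_le (hcls i.1) (hU i)
  obtain ⟨f, hf⟩ := exists_forall_exists_forall_eq e
    (fun i v => decide (∃ j, i.2 j = (v.1, true))) hS hZ hlt
  refine ⟨f, fun hxy h => by simp [blowup, hxy, h], fun c F hF p => ?_⟩
  obtain ⟨u, hu⟩ := exists_subset_range_fin hF
  obtain ⟨⟨z, hzc, hzu⟩, hz⟩ := hf (c, fun j => (u j, decide (p (u j))))
  replace hu : ∀ v ∈ F, v ∈ U (c, fun j => (u j, decide (p (u j)))) := by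
    simpa [U, Set.subset_def] using hu
  refine ⟨z, hzc, fun hzF => hzu (hu z hzF), fun v hv hnone => ?_⟩
  have hvz : v ≠ z := fun h => hzu (hu z (h ▸ hv))
  have hfp : f s(z, v) = true ↔ p v := by
    obtain ⟨j, rfl⟩ : v ∈ Set.range u := by simpa [U] using hu v hv
    refine (Bool.eq_iff_iff.1 (hz ⟨u j, hu _ hv, hnone⟩)).trans ?_
    simp only [Prod.mk.injEq, decide_eq_true_eq]
    exact ⟨fun ⟨_, hk, hp⟩ => hk ▸ hp, fun hp => ⟨j, rfl, hp⟩⟩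
  simp [blowup, hvz, hzc, T.symm, hnone, hfp, Sym2.eq_swap]

theorem Template.exists_isGeneric [Finite C] [Nonempty C] (T : Template C) (t : ℕ) :
    ∃ (n : ℕ) (cls : Fin n → C) (G : SimpleGraph (Fin n)), IsGeneric T t cls G := by
  have := Fintype.ofFinite C
  have hq₀ : (0 : ℝ) ≤ 1 - (1 / 2) ^ t := sub_nonneg.2 (pow_le_one₀ (by norm_num) (by norm_num))
  have hq₁ : (1 - (1 / 2) ^ t : ℝ) < 1 := sub_lt_self _ (by positivity)
  obtain ⟨M, htM, hM, hlt⟩ := exists_le_pow_mul_pow_lt_one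
    (Fintype.card C * (4 * Fintype.card C) ^ t) t hq₀ hq₁
  have : NeZero (2 * M) := ⟨by lia⟩
  let n := Fintype.card (C × Fin (2 * M))
  let e : Fin n ≃ C × Fin (2 * M) := (Fintype.equivFin _).symm
  have : Nonempty (Fin n) := e.nonempty
  have hcls (c : C) : M + t ≤ Nat.card {x // (e x).1 = c} := by
    have hinj : Function.Injective fun k =>
        (⟨e.symm (c, k), by simp⟩ : {x // (e x).1 = c}) := fun _ _ h => by simpa using h
    have := Nat.card_le_card_of_injective _ hinj
    rw [Nat.card_fin] at this
    lia
  obtain ⟨f, hf⟩ := T.exists_isGeneric_blowup (fun x => (e x).1) hcls (t := t) (M := M) (by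
    convert hlt using 1
    simp [n]
    ring)
  exact ⟨n, _, _, hf⟩

namespace IsGeneric

variable {T : Template C} {t : ℕ} {cls : V → C} {G : SimpleGraph V}

theorem exists_cls_eq (hG : IsGeneric T t cls G) (c : C) : ∃ x, cls x = c :=
  (hG.exists_pattern c (F := ∅) (by simp) fun _ => True).imp fun _ h => h.1

theorem adj (hG : IsGeneric T t cls G) {x y : V} (hxy : x ≠ y)
    (h : T.status (cls x) (cls y) = some true) : G.Adj x y :=
  (hG.adj_iff hxy h).2 rfl

theorem not_adj (hG : IsGeneric T t cls G) {x y : V}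
    (h : T.status (cls x) (cls y) = some false) : ¬ G.Adj x y := fun hxy => by
  simpa using (hG.adj_iff hxy.ne h).1 hxy

theorem extensionProperty (hG : IsGeneric T t cls G) {s : ℕ} (hst : s ≤ t)
    (h : ∀ S : Finset V, S.card ≤ s → ∃ c, ∀ v ∈ S, T.status c (cls v) = none) :
    ExtensionProperty s G := by
  refine extensionProperty_of_exists_pattern fun S hS p => ?_
  obtain ⟨c, hc⟩ := h S hS
  obtain ⟨z, -, hz, hadj⟩ := hG.exists_pattern c (hS.trans hst) p
  exact ⟨z, hz, fun v hv => hadj v hv (hc v hv)⟩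

theorem injOn_of_isClique (hG : IsGeneric T t cls G) {X : Set V} (hX : G.IsClique X) :
    Set.InjOn cls X := by
  intro x hx y hy hxy
  by_contra hne
  exact hG.not_adj (by rw [hxy, T.self]) (hX hx hy hne)

theorem status_ne_some_false_of_isClique (hG : IsGeneric T t cls G) {X : Set V}
    (hX : G.IsClique X) {x y : V} (hx : x ∈ X) (hy : y ∈ X) (hxy : cls x ≠ cls y) :
    T.status (cls x) (cls y) ≠ some false :=
  fun h => hG.not_adj h (hX hx hy (ne_of_apply_ne cls hxy))

theorem exists_forall_adj_iff [Fintype C] (hG : IsGeneric T t cls G) (ht : Fintype.card C ≤ t)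
    {X : Set V} (hX : G.IsClique X) (b : Bool) (c : C)
    (hc : ∀ x ∈ X, T.status c (cls x) ≠ some (!b)) :
    ∃ z, z ∉ X ∧ ∀ x ∈ X, (G.Adj z x ↔ b = true) := by
  classical
  have hinj := hG.injOn_of_isClique hX
  lift X to Finset V using .of_finite_image (Set.toFinite _) hinj
  have hcard : X.card ≤ t := by
    rw [← Finset.card_image_of_injOn hinj]
    exact (Finset.card_le_univ _).trans ht
  obtain ⟨z, hzc, hzX, hz⟩ := hG.exists_pattern c hcard fun _ => b = true
  refine ⟨z, hzX, fun x hx => ?_⟩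
  have hne : z ≠ x := fun h => hzX (h ▸ hx)
  cases hstatus : T.status c (cls x) with
  | none => rw [G.adj_comm, hz x hx hstatus]
  | some b' =>
    obtain rfl : b' = b := by simpa [hstatus, Bool.eq_not] using hc x hx
    exact hG.adj_iff hne (hzc ▸ hstatus)

theorem extNonAdj [Fintype C] (hG : IsGeneric T t cls G) (ht : Fintype.card C ≤ t) {X : Set V}
    (hX : G.IsClique X) (c : C) (hc : ∀ x ∈ X, T.status c (cls x) ≠ some true) :
    ExtNonAdj G X := by
  simpa [ExtNonAdj] using hG.exists_forall_adj_iff ht hX false c hc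

theorem extAdj [Fintype C] (hG : IsGeneric T t cls G) (ht : Fintype.card C ≤ t) {X : Set V}
    (hX : G.IsClique X) (c : C) (hc : ∀ x ∈ X, T.status c (cls x) ≠ some false) :
    ExtAdj G X := by
  simpa [ExtAdj] using hG.exists_forall_adj_iff ht hX true c hc

end IsGeneric

end Generic

theorem exists_forall_ne_of_card_lt {α β : Type*} [Fintype β] (f : α → β) {S : Finset α}
    (hS : S.card < Fintype.card β) : ∃ b, ∀ a ∈ S, f a ≠ b := by
  classical
  obtain ⟨b, -, hb⟩ := Finset.exists_mem_notMem_of_card_lt_card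
    (s := S.image f) (t := Finset.univ) (Finset.card_image_le.trans_lt hS)
  exact ⟨b, by simpa using hb⟩

/-! ### Graphs without dominating cliques -/

/-- The template of the `n`-partite graphs with no other prescribed adjacencies. Its generic graphs
have no clique that dominates all other vertices. -/
def multipartiteTemplate (n : ℕ) : Template (Fin n) where
  status i j := if i = j then some false else none
  symm i j := by simp [eq_comm]
  self i := by simp

section Multipartite

variable {V : Type*} {n t : ℕ} {G : SimpleGraph V}

theorem extensionProperty_of_multipartite {s : ℕ} {cls : V → Fin n}
    (hG : IsGeneric (multipartiteTemplate n) t cls G) (hn : s < n) (ht : s ≤ t) :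
    ExtensionProperty s G := by
  refine hG.extensionProperty ht fun S hS => ?_
  obtain ⟨i, hi⟩ := exists_forall_ne_of_card_lt cls (S := S) (by simpa using hS.trans_lt hn)
  exact ⟨i, fun v hv => if_neg (hi v hv).symm⟩

theorem phiC1_of_multipartite {cls : V → Fin (n + 1)}
    (hG : IsGeneric (multipartiteTemplate (n + 1)) t cls G) (ht : n + 1 ≤ t) : PhiC1 G :=
  fun _ hX => hG.extNonAdj (by simpa using ht) hX 0 fun _ _ => by simp [multipartiteTemplate]

end Multipartite

/-! ### Graphs with dominating cliques -/

/-- The classes of vertices of the graphs with a dominating clique: the `ground` vertices, in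
parts `i`, the `dominator` vertices, in parts `j`, and `extra` vertices. A ground vertex is
dominated by the dominators in its second coordinate; the first coordinate of a dominator is a
label. -/
inductive DomClass (n : ℕ) (ε : Type)
  | ground (i j : Fin (n + 2))
  | dominator (i j : Fin (n + 2))
  | extra (e : ε)
  deriving Fintype

namespace DomClass

variable {n : ℕ} {ε : Type}

/-- The prescribed adjacencies. If the dominators are `labelled`, then those with the label `i` are
adjacent to the whole part `i` of the ground, and cliques contain dominators of one label only. -/
def status (labelled : Bool) : DomClass n ε → DomClass n ε → Option Bool
  | ground i _, ground i' _ => if i = i' then some false else none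
  | ground i j, dominator i' j' | dominator i' j', ground i j =>
      if j = j' ∨ (labelled ∧ i = i') then some true else none
  | dominator i j, dominator i' j' =>
      if j = j' then some false
      else if labelled then (if i = i' then none else some false)
      else some true
  | extra _, ground _ _ | ground _ _, extra _ => none
  | extra _, dominator _ j | dominator _ j, extra _ => some (j ≠ 0)
  | extra _, extra _ => some false

/-- The template with the adjacencies prescribed by `DomClass.status`. -/
def template (n : ℕ) (ε : Type) (labelled : Bool) : Template (DomClass n ε) where
  status := status labelled
  symm c d := by cases c <;> cases d <;> simp only [status, eq_comm]
  self c := by cases c <;> simp [status]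

instance : Nonempty (DomClass n ε) := ⟨ground 0 0⟩

/-- The part of a ground vertex, and the label of a dominator; `0` is a junk value. -/
def firstCoord : DomClass n ε → Fin (n + 2)
  | ground i _ | dominator i _ => i
  | extra _ => 0

/-- The part of a dominator, and the part of the dominators that dominates a ground vertex; `0` is
a junk value. -/
def secondCoord : DomClass n ε → Fin (n + 2)
  | ground _ j | dominator _ j => j
  | extra _ => 0

end DomClass

section Domination

open DomClass

variable {V : Type*} {n s t : ℕ} {ε : Type} {labelled : Bool} {cls : V → DomClass n ε}
  {G : SimpleGraph V} {X : Set V}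

/-- `X` contains a dominator in each part: together, these dominate the ground. -/
def MeetsDominators (cls : V → DomClass n ε) (X : Set V) : Prop :=
  ∀ j, ∃ x ∈ X, ∃ i, cls x = dominator i j

/-- `X` contains a ground vertex in each part: together, these dominate the dominators of a
template with labels, as a dominator is adjacent to the part of the ground given by its label. -/
def MeetsGround (cls : V → DomClass n ε) (X : Set V) : Prop :=
  ∀ i, ∃ x ∈ X, ∃ j, cls x = ground i j

theorem extensionProperty_of_domination (hG : IsGeneric (template n ε labelled) t cls G)
    (hs : s ≤ n) (ht : s ≤ t) : ExtensionProperty s G := by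
  refine hG.extensionProperty ht fun S hS => ?_
  have hlt : S.card < Fintype.card (Fin (n + 2)) := by
    rw [Fintype.card_fin]
    lia
  obtain ⟨i, hi⟩ := exists_forall_ne_of_card_lt (fun v => (cls v).firstCoord) hlt
  obtain ⟨j, hj⟩ := exists_forall_ne_of_card_lt (fun v => (cls v).secondCoord) hlt
  refine ⟨ground i j, fun v hv => ?_⟩
  specialize hi v hv
  specialize hj v hv
  cases h : cls v <;> simp_all [template, status, firstCoord, secondCoord, eq_comm]

theorem exists_forall_label_eq (hG : IsGeneric (template n ε labelled) t cls G)
    (hX : G.IsClique X) : ∃ l, labelled → ∀ x ∈ X, ∀ i j, cls x = dominator i j → i = l := by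
  by_cases h : ∃ x ∈ X, ∃ i j, cls x = dominator i j
  · obtain ⟨x, hx, l, j, hxl⟩ := h
    refine ⟨l, fun hlabelled y hy i j' hyi => ?_⟩
    by_contra hne
    exact hG.status_ne_some_false_of_isClique hX hx hy (by simp [hxl, hyi, Ne.symm hne])
      (by simp [hxl, hyi, template, status, Ne.symm hne, hlabelled])
  · push Not at h
    exact ⟨0, fun _ x hx i j hxi => absurd hxi (h x hx i j)⟩

theorem meetsDominators_of_not_extNonAdj [Fintype ε]
    (hG : IsGeneric (template n ε labelled) t cls G) (ht : Fintype.card (DomClass n ε) ≤ t)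
    (hX : G.IsClique X) (h : ¬ ExtNonAdj G X) : MeetsDominators cls X := by
  intro j
  by_contra! hj
  obtain ⟨i, hi⟩ := exists_forall_label_eq hG hX
  obtain ⟨l, hl⟩ := exists_ne i
  refine h (hG.extNonAdj ht hX (ground l j) fun x hx => ?_)
  specialize hj x hx
  cases hcls : cls x with
  | ground i' j' => simp [template, status]
  | dominator i' j' =>
    have hjj' : j ≠ j' := fun h => hj i' (h ▸ hcls)
    have hli : labelled → l ≠ i' := fun h => hi h x hx i' j' hcls ▸ hl
    simpa [template, status, hjj'] using hli
  | extra e => simp [template, status]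

theorem cls_ne_extra_of_meetsDominators (hG : IsGeneric (template n ε labelled) t cls G)
    (hX : G.IsClique X) (h : MeetsDominators cls X) {x : V} (hx : x ∈ X) (e : ε) :
    cls x ≠ extra e := by
  intro hxe
  obtain ⟨y, hy, i, hyi⟩ := h 0
  exact hG.status_ne_some_false_of_isClique hX hx hy (by simp [hxe, hyi])
    (by simp [hxe, hyi, template, status])

theorem exists_forall_cls_ne_ground_of_not_meetsGround
    (hG : IsGeneric (template n ε labelled) t cls G) (hX : G.IsClique X)
    (h : ¬ MeetsGround cls X) : ∃ j, ∀ x ∈ X, ∀ i, cls x ≠ ground i j := by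
  by_contra! hall
  choose x hx i hi using hall
  have hinj : i.Injective := by
    intro j j' hij
    by_contra hne
    exact hG.status_ne_some_false_of_isClique hX (hx j) (hx j') (by simp [hi, hne])
      (by simp [hi, hij, template, status])
  refine h fun k => ?_
  obtain ⟨j, rfl⟩ := Finite.surjective_of_injective hinj k
  exact ⟨x j, hx j, j, hi j⟩

theorem meetsGround_of_not_extNonAdj [Fintype ε] (hG : IsGeneric (template n ε true) t cls G)
    (ht : Fintype.card (DomClass n ε) ≤ t) (hX : G.IsClique X) (h : ¬ ExtNonAdj G X) :
    MeetsGround cls X := by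
  by_contra hground
  have hdom := meetsDominators_of_not_extNonAdj hG ht hX h
  obtain ⟨j, hj⟩ := exists_forall_cls_ne_ground_of_not_meetsGround hG hX hground
  obtain ⟨i, hi⟩ := not_forall.1 hground
  push Not at hi
  refine h (hG.extNonAdj ht hX (dominator i j) fun x hx => ?_)
  cases hcls : cls x with
  | ground i' j' =>
    have hii' : i' ≠ i := fun h => hi x hx j' (h ▸ hcls)
    have hjj' : j' ≠ j := fun h => hj x hx i' (h ▸ hcls)
    simp [template, status, hii', hjj']
  | dominator i' j' =>
    simp only [template, status]
    split_ifs <;> simp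
  | extra e => exact absurd hcls (cls_ne_extra_of_meetsDominators hG hX hdom hx e)

theorem meetsGround_of_not_extAdj [Fintype ε] (hG : IsGeneric (template n ε labelled) t cls G)
    (ht : Fintype.card (DomClass n ε) ≤ t) (hX : G.IsClique X) (h : ¬ ExtAdj G X) :
    MeetsGround cls X := by
  intro i
  by_contra! hi
  refine h (hG.extAdj ht hX (ground i 0) fun x hx => ?_)
  cases hcls : cls x with
  | ground i' j' =>
    have hii' : i ≠ i' := fun h => hi x hx j' (h ▸ hcls)
    simp [template, status, hii']
  | dominator i' j' => simp [template, status]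
  | extra e => simp [template, status]

theorem meetsDominators_of_not_extAdj [Fintype ε]
    (hG : IsGeneric (template n ε labelled) t cls G) (ht : Fintype.card (DomClass n ε) ≤ t)
    (hX : G.IsClique X) (hextra : ∀ x ∈ X, ∀ e, cls x ≠ extra e) (h : ¬ ExtAdj G X) :
    MeetsDominators cls X := by
  intro j
  by_contra! hj
  obtain ⟨l, hl⟩ := exists_forall_label_eq hG hX
  refine h (hG.extAdj ht hX (dominator l j) fun x hx => ?_)
  cases hcls : cls x with
  | ground i' j' => simp [template, status]
  | dominator i' j' =>
    have hjj' : j ≠ j' := fun h => hj x hx i' (h ▸ hcls)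
    have hli : labelled → i' = l := fun h => hl h x hx i' j' hcls
    cases labelled with
    | false => simp [template, status, hjj']
    | true => simp [template, status, hjj', hli rfl]
  | extra e => exact absurd hcls (hextra x hx e)

theorem not_extAdj_of_meets (hG : IsGeneric (template n ε labelled) t cls G)
    (hdom : MeetsDominators cls X) (hground : MeetsGround cls X) : ¬ ExtAdj G X := by
  rintro ⟨z, -, hadj⟩
  cases hz : cls z with
  | ground i j =>
    obtain ⟨x, hx, j', hxj⟩ := hground i
    exact hG.not_adj (by simp [hz, hxj, template, status]) (hadj x hx)
  | dominator i j =>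
    obtain ⟨x, hx, i', hxi⟩ := hdom j
    exact hG.not_adj (by simp [hz, hxi, template, status]) (hadj x hx)
  | extra e =>
    obtain ⟨x, hx, i', hxi⟩ := hdom 0
    exact hG.not_adj (by simp [hz, hxi, template, status]) (hadj x hx)

theorem not_extNonAdj_of_meets (hG : IsGeneric (template n ε labelled) t cls G)
    (hdom : MeetsDominators cls X) (hground : labelled → MeetsGround cls X) :
    ¬ ExtNonAdj G X := by
  rintro ⟨z, hzX, hadj⟩
  suffices h : ∃ x ∈ X, (template n ε labelled).status (cls z) (cls x) = some true by
    obtain ⟨x, hx, hzx⟩ := h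
    exact hadj x hx (hG.adj (fun h => hzX (h ▸ hx)) hzx)
  cases hz : cls z with
  | ground i j =>
    obtain ⟨x, hx, i', hxi⟩ := hdom j
    exact ⟨x, hx, by simp [hxi, template, status]⟩
  | dominator i j =>
    cases labelled with
    | true =>
      obtain ⟨x, hx, j', hxj⟩ := hground rfl i
      exact ⟨x, hx, by simp [hxj, template, status]⟩
    | false =>
      obtain ⟨j', hj'⟩ := exists_ne j
      obtain ⟨x, hx, i', hxi⟩ := hdom j'
      exact ⟨x, hx, by simp [hxi, template, status, hj'.symm]⟩
  | extra e =>
    obtain ⟨x, hx, i', hxi⟩ := hdom 1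
    exact ⟨x, hx, by simp [hxi, template, status]⟩

theorem phiC2_of_isEmpty_extra [Fintype ε] [IsEmpty ε]
    (hG : IsGeneric (template n ε labelled) t cls G) (ht : Fintype.card (DomClass n ε) ≤ t) :
    PhiC2 G := fun _ hX =>
  not_extNonAdj_of_meets hG
    (meetsDominators_of_not_extAdj hG ht hX.1 (fun _ _ => isEmptyElim) hX.2)
    fun _ => meetsGround_of_not_extAdj hG ht hX.1 hX.2

theorem not_phiC2_of_nonempty_extra [Fintype ε] [Nonempty ε]
    (hG : IsGeneric (template n ε labelled) t cls G) (ht : Fintype.card (DomClass n ε) ≤ t) :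
    ¬ PhiC2 G := by
  intro h
  obtain ⟨e⟩ := ‹Nonempty ε›
  obtain ⟨x, hxe⟩ := hG.exists_cls_eq (extra e)
  obtain ⟨X, hxX, hX⟩ := exists_maxClique_superset (SimpleGraph.isClique_singleton (G := G) x)
  exact cls_ne_extra_of_meetsDominators hG hX.1
    (meetsDominators_of_not_extNonAdj hG ht hX.1 (h X hX)) (hxX rfl) e hxe

theorem phiC3_of_labelled [Fintype ε] (hG : IsGeneric (template n ε true) t cls G)
    (ht : Fintype.card (DomClass n ε) ≤ t) : PhiC3 G := fun _ hX =>
  ⟨hX.1, not_extAdj_of_meets hG (meetsDominators_of_not_extNonAdj hG ht hX.1 hX.2)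
    (meetsGround_of_not_extNonAdj hG ht hX.1 hX.2)⟩

theorem not_phiC1_of_labelled [Fintype ε] (hG : IsGeneric (template n ε true) t cls G)
    (ht : Fintype.card (DomClass n ε) ≤ t) : ¬ PhiC1 G := by
  intro h
  obtain ⟨x, hx⟩ := hG.exists_cls_eq (dominator 0 0)
  obtain ⟨X, hxX, hX⟩ := exists_maxClique_superset (SimpleGraph.isClique_singleton (G := G) x)
  have hextra : ∀ y ∈ X, ∀ e, cls y ≠ extra e := by
    intro y hy e hye
    exact hG.status_ne_some_false_of_isClique hX.1 (hxX rfl) hy (by simp [hx, hye])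
      (by simp [hx, hye, template, status])
  exact not_extNonAdj_of_meets hG (meetsDominators_of_not_extAdj hG ht hX.1 hextra hX.2)
    (fun _ => meetsGround_of_not_extAdj hG ht hX.1 hX.2) (h X hX.1)

theorem exists_isClique_not_extNonAdj_extAdj [Fintype ε]
    (hG : IsGeneric (template n ε false) t cls G) (ht : Fintype.card (DomClass n ε) ≤ t) :
    ∃ X, G.IsClique X ∧ ¬ ExtNonAdj G X ∧ ExtAdj G X := by
  choose x hx using fun j => hG.exists_cls_eq (dominator 0 j)
  have hclique : G.IsClique (Set.range x) := by
    rintro _ ⟨j, rfl⟩ _ ⟨j', rfl⟩ hne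
    have : j ≠ j' := fun h => hne (h ▸ rfl)
    exact hG.adj hne (by simp [hx, template, status, this])
  refine ⟨Set.range x, hclique,
    not_extNonAdj_of_meets hG (fun j => ⟨x j, ⟨j, rfl⟩, 0, hx j⟩) (by simp), ?_⟩
  by_contra h
  obtain ⟨_, ⟨j, rfl⟩, j', hj'⟩ := meetsGround_of_not_extAdj hG ht hclique h 0
  simp [hx] at hj'

theorem not_phiC1_of_unlabelled [Fintype ε] (hG : IsGeneric (template n ε false) t cls G)
    (ht : Fintype.card (DomClass n ε) ≤ t) : ¬ PhiC1 G := fun h =>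
  have ⟨X, hX, hext, _⟩ := exists_isClique_not_extNonAdj_extAdj hG ht
  hext (h X hX)

theorem not_phiC3_of_unlabelled [Fintype ε] (hG : IsGeneric (template n ε false) t cls G)
    (ht : Fintype.card (DomClass n ε) ≤ t) : ¬ PhiC3 G := fun h =>
  have ⟨X, hX, hext, hadj⟩ := exists_isClique_not_extNonAdj_extAdj hG ht
  (h X ⟨hX, hext⟩).2 hadj

theorem exists_domination (s : ℕ) (ε : Type) [Fintype ε] (labelled : Bool) :
    ∃ (n : ℕ) (cls : Fin n → DomClass s ε) (G : SimpleGraph (Fin n)),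
      0 < n ∧ ExtensionProperty s G ∧
        IsGeneric (template s ε labelled) (Fintype.card (DomClass s ε) + s) cls G := by
  obtain ⟨n, cls, G, hG⟩ :=
    (template s ε labelled).exists_isGeneric (Fintype.card (DomClass s ε) + s)
  obtain ⟨x, -⟩ := hG.exists_cls_eq (ground 0 0)
  exact ⟨n, cls, G, x.pos, extensionProperty_of_domination hG le_rfl (Nat.le_add_left ..), hG⟩

end Domination

theorem exists_extensionProperty_phiC1 (s : ℕ) :
    ∃ (n : ℕ) (G : SimpleGraph (Fin n)), 0 < n ∧ ExtensionProperty s G ∧ PhiC1 G := by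
  obtain ⟨n, cls, G, hG⟩ := (multipartiteTemplate (s + 1)).exists_isGeneric (s + 1)
  obtain ⟨x, -⟩ := hG.exists_cls_eq 0
  exact ⟨n, G, x.pos, extensionProperty_of_multipartite hG s.lt_succ_self s.le_succ,
    phiC1_of_multipartite hG le_rfl⟩

theorem exists_fiveCases (s : ℕ) (i : Fin 5) :
    ∃ (n : ℕ) (G : SimpleGraph (Fin n)), 0 < n ∧ ExtensionProperty s G ∧
      FiveCases (PhiC1 G) (PhiC2 G) (PhiC3 G) i := by
  have hle (k : ℕ) : k ≤ k + s := Nat.le_add_right k s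
  match i with
  | 0 => exact exists_extensionProperty_phiC1 s
  | 1 =>
    obtain ⟨n, cls, G, hn, hs, hG⟩ := exists_domination s Unit true
    exact ⟨n, G, hn, hs, not_phiC1_of_labelled hG (hle _),
      not_phiC2_of_nonempty_extra hG (hle _), phiC3_of_labelled hG (hle _)⟩
  | 2 =>
    obtain ⟨n, cls, G, hn, hs, hG⟩ := exists_domination s Unit false
    exact ⟨n, G, hn, hs, not_phiC1_of_unlabelled hG (hle _),
      not_phiC2_of_nonempty_extra hG (hle _), not_phiC3_of_unlabelled hG (hle _)⟩
  | 3 =>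
    obtain ⟨n, cls, G, hn, hs, hG⟩ := exists_domination s Empty true
    exact ⟨n, G, hn, hs, phiC2_of_isEmpty_extra hG (hle _), phiC3_of_labelled hG (hle _)⟩
  | 4 =>
    obtain ⟨n, cls, G, hn, hs, hG⟩ := exists_domination s Empty false
    exact ⟨n, G, hn, hs, phiC2_of_isEmpty_extra hG (hle _), not_phiC3_of_unlabelled hG (hle _)⟩

theorem exists_fiveCases_indep (s : ℕ) (i : Fin 5) :
    ∃ (n : ℕ) (G : SimpleGraph (Fin n)), 0 < n ∧ ExtensionProperty s G ∧
      FiveCases (PhiI1 G) (PhiI2 G) (PhiI3 G) i := by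
  obtain ⟨n, G, hn, hs, hG⟩ := exists_fiveCases s i
  have : Nonempty (Fin n) := Fin.pos_iff_nonempty.1 hn
  refine ⟨n, Gᶜ, hn, hs.compl, ?_⟩
  rwa [← phiC1_compl, ← phiC2_compl, ← phiC3_compl, compl_compl]

end MonadicGraph

open MonadicGraph in
theorem theorem4 :
    (∃ s : ℕ, 0 < s ∧
      ∀ (V : Type*) (W : Type*) [Nonempty V] [Nonempty W]
        (G : SimpleGraph V) (H : SimpleGraph W),
        ExtensionProperty s G → ExtensionProperty s H →
        (PhiC1 G ↔ PhiC1 H) → (PhiC2 G ↔ PhiC2 H) → (PhiC3 G ↔ PhiC3 H) →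
        (PhiI1 G ↔ PhiI1 H) → (PhiI2 G ↔ PhiI2 H) → (PhiI3 G ↔ PhiI3 H) →
        ∀ Ψ : E12Sentence, Ψ.Holds G ↔ Ψ.Holds H) ∧
    (∀ s : ℕ, 0 < s → ∀ i : Fin 5,
      (∃ (n : ℕ) (G : SimpleGraph (Fin n)), 0 < n ∧ ExtensionProperty s G ∧
        FiveCases (PhiC1 G) (PhiC2 G) (PhiC3 G) i) ∧
      (∃ (n : ℕ) (G : SimpleGraph (Fin n)), 0 < n ∧ ExtensionProperty s G ∧
        FiveCases (PhiI1 G) (PhiI2 G) (PhiI3 G) i)) := by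
  refine ⟨⟨4, by norm_num, ?_⟩, fun s _ i => ⟨exists_fiveCases s i, exists_fiveCases_indep s i⟩⟩
  intro V W _ _ G H hG hH hC₁ hC₂ hC₃ hI₁ hI₂ hI₃ Ψ
  exact Ψ.holds_iff hG hH le_rfl ⟨hC₁, hC₂, hC₃⟩ (cliqueEquivalent_compl hI₁ hI₂ hI₃)
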